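/- Throughout, $[n]=\{1,\dots,n\}$, and $P_j$ is the path on $[j]$ with edges $\{i,i+1\}$. For a finite multigraph $M$ (loops allowed) let $X_M(\mathbf x)=\sum_\kappa\prod_{v}x_{\kappa(v)}$ be its chromatic symmetric function, where $\kappa$ runs over all proper colourings of the vertices of $M$ by positive integers (the two ends of every edge get different colours, so $X_M=0$ if $M$ has a loop). For a finite multiset $\lambda$ of positive integers let $e_\lambda=\prod_i e_{\lambda_i}$, where $e_k=\sum_{i_1<\cdots<i_k}x_{i_1}\cdots x_{i_k}$. Let $G=([n],E)$ be a simple graph with $n\ge 2$. For $j\ge1$ let $G+P_j$ be the graph on $[n+j-1]$ with edge set $E\cup\{\{n+t-1,n+t\}: 1\le t\le j-1\}$, and fix a total order on the edges of $G+P_j$. A *tree triple* of $G+P_j$ is a triple $(T,\alpha,r)$ consisting of a subtree $T$ of $G+P_j$ whose edge set contains no set of the form $C\setminus\{\max C\}$ with $C$ the edge set of a cycle of $G+P_j$, a composition $\alpha=(\alpha_1,\dots,\alpha_\ell)$ of the number of vertices of $T$, and an integer $1\le r\le\alpha_1$. A *forest triple* of $G+P_j$ is a sequence $\mathcal F=((T_1,\alpha^{(1)},r_1),\dots,(T_m,\alpha^{(m)},r_m))$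 of tree triples such that every vertex lies in exactly one $T_i$ and $\min T_1<\cdots<\min T_m$. Put $\operatorname{sign}(\mathcal F)=(-1)^{\sum_i(\ell(\alpha^{(i)})-1)}$ and let $\operatorname{type}'(\mathcal F)$ be the multiset of all parts of $\alpha^{(1)},\dots,\alpha^{(m)}$ with one instance of $\alpha^{(1)}_1$ removed. For $i,j\ge1$ let $\mathrm{FT}^{(i)}(G+P_j)$ be the set of forest triples of $G+P_j$ for which the tree triple $(T,\alpha,r)$ with $1\in T$ satisfies $\alpha_1=i$ and $r=1$, and the tree triple $(T',\alpha',r')$ with $n\in T'$ satisfies $\{n,n+1,\dots,n+j-1\}\subseteq T'$ and has last part $\alpha'_\ell\ge j$. The *forest triple matrix* $F_G$ is the infinite matrix with entries $$(F_G)_{i,j}=\sum_{\mathcal F\in\mathrm{FT}^{(i)}(G+P_j)}\operatorname{sign}(\mathcal F)\,e_{\operatorname{type}'(\mathcal F)}\qquad(i,j\ge1).$$ Let $G^\circ$ be the multigraph on $[n-1]$ obtained from $G$ by identifying the vertices $1$ and $n$; each edge of $G$ gives one edge of $G^\circ$, so multiple edges may arise, and an edge $\{1,n\}$ becomes a loop.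 **Theorem.** For every choice of the total orders, $(F_G)_{k,k}=0$ for all $k\ge n$, and $$X_{G^\circ}(\mathbf x)=\operatorname{trace}(F_G)=\sum_{k\ge1}(F_G)_{k,k}=\sum_{k=1}^{n-1}(F_G)_{k,k}.$$ -/

import Mathlib

/-! Vertices are indexed from `0`: the vertex `v ∈ {1, …, n}` is the element of `Fin n` with value
`v - 1`. Symmetric functions are power series over `ℤ` in the variables `x₁, x₂, …`, indexed
by `ℕ+`. -/

noncomputable section

namespace ForestTriples

/-! ### Symmetric functions -/

/-- The ring of formal power series in the variables `x₁, x₂, x₃, …`. -/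
abbrev PowerSeriesRing : Type := MvPowerSeries ℕ+ ℤ

open Classical in
/-- The elementary symmetric function `e_k`: the sum of the squarefree monomials
`∏ i ∈ s, x_i` over all `k`-element sets `s` of positive integers. -/
def elementary (k : ℕ) : PowerSeriesRing := fun d =>
  if ∃ s : Finset ℕ+, s.card = k ∧ ∑ i ∈ s, Finsupp.single i 1 = d then 1 else 0

/-- `e_λ = ∏ e_{λ_i}`, where the partition `λ` is given by the multiset of its parts. -/
def elementaryProd (lam : Multiset ℕ) : PowerSeriesRing := (lam.map elementary).prod

/-- Proper colourings of a multigraph (possibly with loops) by positive integers. A multigraph with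
a loop has none. -/
def IsProperColouring {α β : Type*} (M : Graph α β) (κ : M.vertexSet → ℕ+) : Prop :=
  ∀ (e : β) (x y : M.vertexSet), M.IsLink e x y → κ x ≠ κ y

/-- The chromatic symmetric function `∑_κ ∏_v x_{κ v}`, summed over the proper colourings `κ`:
the coefficient of a monomial is the (finite) number of proper colourings with that monomial. -/
def chromaticSymmetricFunction {α β : Type*} [Finite α] (M : Graph α β) : PowerSeriesRing :=
  fun d => (Nat.card {κ : M.vertexSet → ℕ+ //
    IsProperColouring M κ ∧ ∑ᶠ v, Finsupp.single (κ v) 1 = d} : ℤ)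

/-! ### Gluing -/

/-- The graph `G + H` on `n + m - 1` vertices, obtained by gluing the last vertex of `G` to the
first vertex of `H`. -/
def glue {n m : ℕ} (G : SimpleGraph (Fin n)) (H : SimpleGraph (Fin m)) :
    SimpleGraph (Fin (n + m - 1)) where
  Adj a b :=
    (∃ u v : Fin n, G.Adj u v ∧ a.val = u.val ∧ b.val = v.val) ∨
    (∃ u v : Fin m, H.Adj u v ∧ a.val = u.val + (n - 1) ∧ b.val = v.val + (n - 1))
  symm := ⟨by
    rintro a b (⟨u, v, h, ha, hb⟩ | ⟨u, v, h, ha, hb⟩)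
    · exact Or.inl ⟨v, u, h.symm, hb, ha⟩
    · exact Or.inr ⟨v, u, h.symm, hb, ha⟩⟩
  loopless := ⟨by
    rintro a (⟨u, v, h, ha, hb⟩ | ⟨u, v, h, ha, hb⟩)
    · exact h.ne (Fin.ext (by omega))
    · exact h.ne (Fin.ext (by omega))⟩

/-- The map `{1, …, n} → {1, …, n - 1}` that sends `n` to `1` and fixes all other vertices. -/
def identifyEnds {n : ℕ} (hn : 2 ≤ n) (v : Fin n) : Fin (n - 1) :=
  if h : v.val < n - 1 then ⟨v.val, h⟩ else ⟨0, by omega⟩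

/-- The multigraph `G°` on `n - 1` vertices obtained from `G` by gluing the vertices `1` and `n`.
Each edge of `G` gives one edge of `G°`; in particular an edge `{1, n}` becomes a loop. -/
def closeUp {n : ℕ} (hn : 2 ≤ n) (G : SimpleGraph (Fin n)) :
    Graph (Fin (n - 1)) (Sym2 (Fin n)) where
  vertexSet := Set.univ
  IsLink e x y := e ∈ G.edgeSet ∧ e.map (identifyEnds hn) = s(x, y)
  isLink_symm := fun _ _ => ⟨fun _ _ h => ⟨h.1, h.2.trans Sym2.eq_swap⟩⟩
  eq_or_eq_of_isLink_of_isLink := by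
    intro e x y v w h h'
    have := h.2.symm.trans h'.2
    rw [Sym2.eq_iff] at this
    tauto
  left_mem_of_isLink := fun _ _ _ _ => Set.mem_univ _

/-! ### Forest triples -/

variable {N : ℕ}

/-- `B` is a broken circuit: `B = C \ {max C}` for the edge set `C` of a cycle of `G`, the maximum
being taken with respect to the total order `o` of the edges. -/
def IsBrokenCircuit (G : SimpleGraph (Fin N)) (o : LinearOrder G.edgeSet)
    (B : Set (Sym2 (Fin N))) : Prop :=
  ∃ (v : Fin N) (c : G.Walk v v) (e : G.edgeSet), c.IsCycle ∧ e.val ∈ c.edges ∧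
    (∀ f : G.edgeSet, f.val ∈ c.edges → o.le f e) ∧ B = {f | f ∈ c.edges} \ {e.val}

/-- The subgraph `T` is a no-broken-circuit tree of `G`. -/
def IsNBCTree (G : SimpleGraph (Fin N)) (o : LinearOrder G.edgeSet) (T : G.Subgraph) : Prop :=
  T.coe.IsTree ∧ ∀ B, IsBrokenCircuit G o B → ¬ B ⊆ T.edgeSet

/-- Tree triples `(T, α, r)`: an NBC tree `T`, a composition `α` of `|T|` (a list of positive
integers with sum `|T|`) and an integer `1 ≤ r ≤ α₁`. -/
@[ext]
structure TreeTriple (G : SimpleGraph (Fin N)) (o : LinearOrder G.edgeSet) where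
  tree : G.Subgraph
  comp : List ℕ
  r : ℕ
  isNBCTree : IsNBCTree G o tree
  comp_pos : ∀ a ∈ comp, 0 < a
  comp_sum : comp.sum = tree.verts.ncard
  one_le_r : 1 ≤ r
  r_le : r ≤ comp.headD 0

variable {G : SimpleGraph (Fin N)} {o : LinearOrder G.edgeSet}

/-- The (value of the) smallest vertex of the tree. -/
def TreeTriple.minVertex (A : TreeTriple G o) : ℕ := sInf (Fin.val '' A.tree.verts)

/-- Forest triples: sequences of tree triples such that every vertex lies in exactly one of the
trees, ordered by the smallest vertices of the trees. -/
@[ext]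
structure ForestTriple (G : SimpleGraph (Fin N)) (o : LinearOrder G.edgeSet) where
  triples : List (TreeTriple G o)
  existsUnique_mem : ∀ v : Fin N, ∃! i : Fin triples.length, v ∈ (triples.get i).tree.verts
  sorted : triples.Pairwise fun A B => A.minVertex < B.minVertex

/-- The type: the partition whose parts are the parts of all the compositions. -/
def ForestTriple.type (F : ForestTriple G o) : Multiset ℕ :=
  (F.triples.flatMap TreeTriple.comp : List ℕ)

/-- The sign `(-1) ^ ∑ (ℓ(α⁽ⁱ⁾) - 1)`. -/
def ForestTriple.sign (F : ForestTriple G o) : ℤ :=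
  (-1) ^ (F.triples.map fun A => A.comp.length - 1).sum

/-- `α⁽¹⁾₁`, the first part of the composition of the first tree triple. -/
def ForestTriple.firstPart (F : ForestTriple G o) : ℕ :=
  (F.triples.map fun A => A.comp.headD 0).headD 0

/-- The reduced type: the type with one instance of `α⁽¹⁾₁` removed. -/
def ForestTriple.reducedType (F : ForestTriple G o) : Multiset ℕ := F.type.erase F.firstPart

/-! ### The forest triple matrix -/

/-- The set `FT⁽ⁱ⁾(G + P_j)` of the forest triples of `G + P_j` such that the tree triple
`(T, α, r)` with `1 ∈ T` has `α₁ = i` and `r = 1`, and the tree triple `(T', α', r')` with `n ∈ T'`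
has `{n, n + 1, …, n + j - 1} ⊆ T'` and last part `α'_ℓ ≥ j`. -/
def restrictedForestTriples {n : ℕ} (G : SimpleGraph (Fin n)) (i j : ℕ+)
    (o : LinearOrder (glue G (SimpleGraph.pathGraph (j : ℕ))).edgeSet) :
    Set (ForestTriple (glue G (SimpleGraph.pathGraph (j : ℕ))) o) :=
  {F | (∃ A ∈ F.triples, (∃ v ∈ A.tree.verts, v.val = 0) ∧
          A.comp.headD 0 = (i : ℕ) ∧ A.r = 1) ∧
       (∃ A ∈ F.triples, (∃ v ∈ A.tree.verts, v.val = n - 1) ∧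
          (∀ v, n - 1 ≤ v.val → v ∈ A.tree.verts) ∧ (j : ℕ) ≤ A.comp.getLastD 0)}

/-- The forest triple matrix `F_G`, with rows and columns indexed by the positive integers. It is
computed from a choice of a total order of the edges of `G + P_j` for every `j`. -/
def forestTripleMatrix {n : ℕ} (G : SimpleGraph (Fin n))
    (o : ∀ j : ℕ+, LinearOrder (glue G (SimpleGraph.pathGraph (j : ℕ))).edgeSet) :
    Matrix ℕ+ ℕ+ PowerSeriesRing := fun i j =>
  ∑ᶠ F ∈ restrictedForestTriples G i j (o j), F.sign • elementaryProd F.reducedType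

/-- The trace of an infinite matrix with finitely many nonzero diagonal entries. -/
def infiniteTrace (M : Matrix ℕ+ ℕ+ PowerSeriesRing) : PowerSeriesRing := ∑ᶠ k, M k k

end ForestTriples

end

/-!
A forest triple of `G + P_j` is an edge set without broken circuits together with independent
decorations of its components, so the sum over the decorations is a product over the components.
By Newton's identity a component of size `m` that contains neither `1` nor `n` contributes
`(-1) ^ (m - 1) * p_m`. Whitney's broken circuit involution then turns the entries of the matrix
into alternating sums over all edge sets `S` of `G`, of weights that depend only on the components
of `S`.

For fixed `S`, sum the diagonal entries over `k`. The weights of the components of `1` and `n` are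
coefficients of products of generating functions, and the relation between the elementary and the
complete symmetric functions collapses the sum to the power sum, up to sign, of the size of the
component of `G°` in which `1` and `n` are glued. The result is the term of `S` in Stanley's
expansion of `X_{G°}` into power sums. The entries with `k ≥ n` vanish because the condition
`α₁ = k` on the component of `1` and, if this component contains `n`, the last part `≥ k` require
too many vertices.
-/

noncomputable section

namespace ForestTriples

/-! ### Sums over compositions -/

/-- The compositions of `m`, encoded as lists of positive integers with sum `m`. -/
def compositionLists (m : ℕ) : Finset (List ℕ) :=
  (Finset.univ : Finset (Composition m)).image Composition.blocks

theorem mem_compositionLists {m : ℕ} {l : List ℕ} :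
    l ∈ compositionLists m ↔ (∀ a ∈ l, 0 < a) ∧ l.sum = m := by
  constructor
  · intro h
    obtain ⟨α, -, rfl⟩ := Finset.mem_image.1 h
    exact ⟨fun a ha => α.blocks_pos ha, α.blocks_sum⟩
  · rintro ⟨h₁, h₂⟩
    exact Finset.mem_image.2 ⟨⟨l, fun {a} ha => h₁ a ha, h₂⟩, Finset.mem_univ _, rfl⟩

theorem cons_mem_compositionLists {m k : ℕ} {l : List ℕ} :
    k :: l ∈ compositionLists m ↔ k ∈ Finset.Icc 1 m ∧ l ∈ compositionLists (m - k) := by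
  simp only [mem_compositionLists, List.forall_mem_cons, List.sum_cons, Finset.mem_Icc]
  constructor
  · rintro ⟨⟨hk, hl⟩, hsum⟩
    exact ⟨by omega, hl, by omega⟩
  · rintro ⟨hk, hl, hsum⟩
    exact ⟨⟨by omega, hl⟩, by omega⟩

theorem nil_mem_compositionLists {m : ℕ} : [] ∈ compositionLists m ↔ m = 0 := by
  simp [mem_compositionLists, eq_comm]

theorem compositionLists_zero : compositionLists 0 = {[]} := by
  ext l
  cases l with
  | nil => simp [nil_mem_compositionLists]
  | cons k l => simp [cons_mem_compositionLists]

section Sums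

variable {M : Type*} [AddCommMonoid M]

theorem sum_composition {m : ℕ} (f : List ℕ → M) :
    ∑ α : Composition m, f α.blocks = ∑ l ∈ compositionLists m, f l := by
  rw [compositionLists, Finset.sum_image]
  exact fun a _ b _ h => Composition.ext h

theorem sum_compositionLists_cons {m : ℕ} (hm : 0 < m) (f : List ℕ → M) :
    ∑ l ∈ compositionLists m, f l =
      ∑ k ∈ Finset.Icc 1 m, ∑ l ∈ compositionLists (m - k), f (k :: l) := by
  rw [Finset.sum_sigma']
  symm
  refine Finset.sum_bij (fun x _ => x.1 :: x.2) (fun x hx => ?_) (fun x _ y _ h => ?_)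
    (fun l hl => ?_) fun _ _ => rfl
  · exact cons_mem_compositionLists.2 (Finset.mem_sigma.1 hx)
  · obtain ⟨h₁, h₂⟩ := List.cons_eq_cons.1 h
    exact Sigma.ext h₁ (heq_of_eq h₂)
  · cases l with
    | nil => exact absurd (nil_mem_compositionLists.1 hl) hm.ne'
    | cons k l => exact ⟨⟨k, l⟩, Finset.mem_sigma.2 (cons_mem_compositionLists.1 hl), rfl⟩

theorem sum_compositionLists_reverse (m : ℕ) (f : List ℕ → M) :
    ∑ l ∈ compositionLists m, f l = ∑ l ∈ compositionLists m, f l.reverse :=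
  Finset.sum_nbij' List.reverse List.reverse (by simp [mem_compositionLists])
    (by simp [mem_compositionLists]) (by simp) (by simp) (by simp)

theorem sum_compositionLists_concat {m : ℕ} (hm : 0 < m) (f : List ℕ → M) :
    ∑ l ∈ compositionLists m, f l =
      ∑ k ∈ Finset.Icc 1 m, ∑ l ∈ compositionLists (m - k), f (l ++ [k]) := by
  rw [sum_compositionLists_reverse, sum_compositionLists_cons hm]
  refine Finset.sum_congr rfl fun k _ => ?_
  rw [sum_compositionLists_reverse]
  simp only [List.reverse_cons, List.reverse_reverse]

end Sums

/-! ### Complete and power sums as polynomials in a sequence -/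

section Sequence

open PowerSeries (mk)

variable {R : Type*} [CommRing R] (e : ℕ → R)

/-- The signed complete symmetric function `(-1)^m h_m`, as the polynomial `∑ (-1)^ℓ(α) e_α` (over
the compositions `α` of `m`) in the elementary ones. It makes sense for any sequence `e`. -/
def signedComplete (m : ℕ) : R :=
  ∑ l ∈ compositionLists m, (-1) ^ l.length * (l.map e).prod

/-- The signed power sum `(-1)^(m-1) p_m`, as the polynomial `∑ (-1)^(ℓ(α)-1) α₁ e_α` (over the
compositions `α` of `m`) in the elementary symmetric functions. It makes sense for any
sequence `e`, and is `0` for `m = 0`. -/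
def signedPowerSum (m : ℕ) : R :=
  ∑ l ∈ compositionLists m, (-1) ^ (l.length - 1) * (l.headD 0 : R) * (l.map e).prod

theorem signedComplete_zero : signedComplete e 0 = 1 := by
  simp [signedComplete, compositionLists_zero]

theorem signedComplete_eq {m : ℕ} (hm : 0 < m) :
    signedComplete e m = -∑ k ∈ Finset.Icc 1 m, e k * signedComplete e (m - k) := by
  rw [signedComplete, sum_compositionLists_cons hm, ← Finset.sum_neg_distrib]
  refine Finset.sum_congr rfl fun k _ => ?_
  rw [signedComplete, Finset.mul_sum, ← Finset.sum_neg_distrib]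
  refine Finset.sum_congr rfl fun l _ => ?_
  rw [List.map_cons, List.prod_cons, List.length_cons, pow_succ]
  ring

theorem signedPowerSum_zero : signedPowerSum e 0 = 0 := by
  simp [signedPowerSum, compositionLists_zero]

theorem signedPowerSum_eq (m : ℕ) :
    signedPowerSum e m = ∑ k ∈ Finset.Icc 1 m, (k : R) * e k * signedComplete e (m - k) := by
  rcases Nat.eq_zero_or_pos m with rfl | hm
  · simp [signedPowerSum_zero]
  rw [signedPowerSum, sum_compositionLists_cons hm]
  refine Finset.sum_congr rfl fun k _ => ?_
  rw [signedComplete, Finset.mul_sum]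
  refine Finset.sum_congr rfl fun l _ => ?_
  rw [List.map_cons, List.prod_cons, List.length_cons, List.headD_cons, Nat.add_sub_cancel]
  ring

theorem coeff_mk_mul_mk (f g : ℕ → R) (m : ℕ) :
    PowerSeries.coeff m (mk f * mk g) = ∑ k ∈ Finset.range (m + 1), f k * g (m - k) := by
  simp only [PowerSeries.coeff_mul, PowerSeries.coeff_mk]
  exact Finset.Nat.sum_antidiagonal_eq_sum_range_succ (fun i j => f i * g j) m

theorem coeff_mk_mul_mk_eq_add_sum_Icc (f g : ℕ → R) (m : ℕ) :
    PowerSeries.coeff m (mk f * mk g) = f 0 * g m + ∑ k ∈ Finset.Icc 1 m, f k * g (m - k) := by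
  rw [coeff_mk_mul_mk, Finset.range_eq_Ico, Finset.sum_eq_sum_Ico_succ_bot m.succ_pos]
  rfl

variable {e}

theorem mk_mul_mk_signedComplete (he : e 0 = 1) : mk e * mk (signedComplete e) = 1 := by
  ext m
  rw [coeff_mk_mul_mk_eq_add_sum_Icc, PowerSeries.coeff_one, he, one_mul]
  split_ifs with h
  · simp [h, signedComplete_zero]
  · rw [signedComplete_eq e (Nat.pos_of_ne_zero h), neg_add_cancel]

variable (e) in
theorem mk_signedPowerSum :
    mk (signedPowerSum e) = mk (fun k => (k : R) * e k) * mk (signedComplete e) := by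
  ext m
  rw [coeff_mk_mul_mk_eq_add_sum_Icc, PowerSeries.coeff_mk, signedPowerSum_eq]
  simp

theorem mk_mul_mk_signedPowerSum (he : e 0 = 1) :
    mk e * mk (signedPowerSum e) = mk fun k => (k : R) * e k := by
  rw [mk_signedPowerSum, mul_left_comm, mk_mul_mk_signedComplete he, mul_one]

theorem natCast_mul_eq_sum_signedPowerSum (he : e 0 = 1) (m : ℕ) :
    (m : R) * e m = ∑ s ∈ Finset.range m, e s * signedPowerSum e (m - s) := by
  have h := congrArg (PowerSeries.coeff m) (mk_mul_mk_signedPowerSum he)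
  rw [coeff_mk_mul_mk, Finset.sum_range_succ, Nat.sub_self, signedPowerSum_zero, mul_zero,
    add_zero, PowerSeries.coeff_mk] at h
  exact h.symm

/-- Newton's recursion determines the power sums, because the generating function of `e` is
invertible. -/
theorem eq_signedPowerSum_of_newton (he : e 0 = 1) {p : ℕ → R}
    (hp : ∀ m : ℕ, (m : R) * e m = ∑ r ∈ Finset.range m, p (r + 1) * e (m - (r + 1))) (m : ℕ) :
    p (m + 1) = signedPowerSum e (m + 1) := by
  have hnewton : mk (fun k => if k = 0 then 0 else p k) * mk e = mk fun k => (k : R) * e k := by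
    ext m
    rw [coeff_mk_mul_mk, Finset.sum_range_succ', PowerSeries.coeff_mk, hp]
    simp
  have h : mk (fun k => if k = 0 then 0 else p k) = mk (signedPowerSum e) := by
    rw [mk_signedPowerSum, ← hnewton, mul_assoc, mk_mul_mk_signedComplete he, mul_one]
  simpa using congrArg (PowerSeries.coeff (m + 1)) h

end Sequence

/-! ### Power sums -/

theorem elementaryProd_coe (l : List ℕ) :
    elementaryProd (l : Multiset ℕ) = (l.map elementary).prod := by
  rw [elementaryProd, Multiset.map_coe, Multiset.prod_coe]

open Classical in
theorem coeff_elementary (m : ℕ) (d : ℕ+ →₀ ℕ) :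
    MvPowerSeries.coeff d (elementary m) = if (∀ i, d i ≤ 1) ∧ d.degree = m then 1 else 0 := by
  change (if _ then _ else _) = _
  refine if_congr ⟨?_, ?_⟩ rfl rfl
  · rintro ⟨s, rfl, rfl⟩
    refine ⟨fun i => ?_, by simp [map_sum]⟩
    rw [Finsupp.finsetSum_apply]
    simp only [Finsupp.single_apply, Finset.sum_ite_eq']
    split_ifs <;> omega
  · rintro ⟨hd, rfl⟩
    have hone : ∀ i ∈ d.support, d i = 1 := fun i hi =>
      le_antisymm (hd i) (Nat.pos_of_ne_zero (Finsupp.mem_support_iff.1 hi))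
    refine ⟨d.support, by simp [Finsupp.degree_apply, Finset.sum_congr rfl hone], ?_⟩
    conv_rhs => rw [← Finsupp.sum_single d]
    exact Finset.sum_congr rfl fun i hi => by rw [hone i hi]

theorem elementary_zero : elementary 0 = 1 := by
  classical
  ext d
  rw [coeff_elementary, MvPowerSeries.coeff_one]
  refine if_congr ⟨fun h => (Finsupp.degree_eq_zero_iff d).1 h.2, ?_⟩ rfl rfl
  rintro rfl
  simp

open Classical in
/-- The power sum symmetric function `p_m`, for `m ≥ 1`. For `m = 0` it is the junk value `1`. -/
def powerSum (m : ℕ) : PowerSeriesRing := fun d =>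
  if ∃ i, Finsupp.single i m = d then 1 else 0

open Classical in
theorem coeff_powerSum (m : ℕ) (d : ℕ+ →₀ ℕ) :
    MvPowerSeries.coeff d (powerSum m) = if ∃ i, Finsupp.single i m = d then 1 else 0 := rfl

theorem coeff_mul_powerSum {r : ℕ} (hr : 0 < r) (f : PowerSeriesRing) (d : ℕ+ →₀ ℕ) :
    MvPowerSeries.coeff d (f * powerSum r) =
      ∑ i ∈ d.support with r ≤ d i, MvPowerSeries.coeff (d - Finsupp.single i r) f := by
  classical
  rw [MvPowerSeries.coeff_mul]
  symm
  refine Finset.sum_of_injOn (fun i => (d - Finsupp.single i r, Finsupp.single i r)) ?_ ?_ ?_ ?_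
  · intro i _ j _ h
    exact (Finsupp.single_left_inj hr.ne').1 (Prod.ext_iff.1 h).2
  · intro i hi
    have hi := (Finset.mem_filter.1 hi).2
    exact Finset.mem_coe.2 (Finset.HasAntidiagonal.mem_antidiagonal.2
      (tsub_add_cancel_of_le (Finsupp.single_le_iff.2 hi)))
  · rintro ⟨u, v⟩ huv hn
    rw [coeff_powerSum, if_neg, mul_zero]
    rintro ⟨i, rfl⟩
    have hd : u + Finsupp.single i r = d := Finset.HasAntidiagonal.mem_antidiagonal.1 huv
    have hdi : u i + r = d i := by rw [← hd, Finsupp.add_apply, Finsupp.single_eq_same]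
    refine hn ⟨i, ?_, by simp only [← hd, add_tsub_cancel_right]⟩
    exact Finset.mem_coe.2 (Finset.mem_filter.2 ⟨Finsupp.mem_support_iff.2 (by omega), by omega⟩)
  · intro i _
    rw [coeff_powerSum r, if_pos ⟨i, rfl⟩, mul_one]

open Classical in
/-- The symmetric function `∑ᵢ xᵢ^r e_{m-r}(xⱼ : j ≠ i)` of degree `m`. It interpolates between the
products of power sums and elementary symmetric functions in Newton's identity. -/
def hookSum (r m : ℕ) : PowerSeriesRing := fun d =>
  ∑ i ∈ d.support, if d.degree = m ∧ d i = r ∧ ∀ j, j ≠ i → d j ≤ 1 then 1 else 0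

open Classical in
theorem coeff_hookSum (r m : ℕ) (d : ℕ+ →₀ ℕ) :
    MvPowerSeries.coeff d (hookSum r m) =
      ∑ i ∈ d.support, if d.degree = m ∧ d i = r ∧ ∀ j, j ≠ i → d j ≤ 1 then 1 else 0 := rfl

theorem hookSum_one (m : ℕ) : hookSum 1 m = m * elementary m := by
  classical
  ext d
  rw [coeff_hookSum, ← nsmul_eq_mul, map_nsmul, nsmul_eq_mul, coeff_elementary]
  have hiff : ∀ i, (d i = 1 ∧ ∀ j, j ≠ i → d j ≤ 1) → ∀ j, d j ≤ 1 := by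
    intro i hi j
    rcases eq_or_ne j i with rfl | hj
    exacts [hi.1.le, hi.2 j hj]
  split_ifs with h
  · obtain ⟨hle, rfl⟩ := h
    have hone : ∀ i ∈ d.support, d i = 1 := fun i hi =>
      le_antisymm (hle i) (Nat.pos_of_ne_zero (Finsupp.mem_support_iff.1 hi))
    rw [Finset.sum_congr rfl fun i hi => if_pos ⟨rfl, hone i hi, fun j _ => hle j⟩,
      Finsupp.degree_apply, Finset.sum_congr rfl hone]
    simp
  · rw [mul_zero]
    exact Finset.sum_eq_zero fun i _ => if_neg fun h' => h ⟨hiff i h'.2, h'.1⟩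

theorem hookSum_eq_zero {r m : ℕ} (h : m < r) : hookSum r m = 0 := by
  classical
  ext d
  rw [coeff_hookSum, map_zero]
  refine Finset.sum_eq_zero fun i _ => if_neg ?_
  rintro ⟨rfl, rfl, -⟩
  exact absurd (Finsupp.le_degree i d) (by omega)

theorem degree_sub_single {d : ℕ+ →₀ ℕ} {i : ℕ+} {r : ℕ} (h : r ≤ d i) :
    (d - Finsupp.single i r).degree + r = d.degree := by
  conv_rhs => rw [← tsub_add_cancel_of_le (Finsupp.single_le_iff.2 h)]
  rw [map_add, Finsupp.degree_single]

theorem forall_sub_single_le_one_iff {d : ℕ+ →₀ ℕ} {i : ℕ+} {r : ℕ} :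
    (∀ j, (d - Finsupp.single i r) j ≤ 1) ↔ d i ≤ r + 1 ∧ ∀ j, j ≠ i → d j ≤ 1 := by
  simp only [Finsupp.tsub_apply]
  constructor
  · refine fun h => ⟨?_, fun j hj => ?_⟩
    · have := h i
      rw [Finsupp.single_eq_same] at this
      omega
    · simpa only [Finsupp.single_eq_of_ne hj, tsub_zero] using h j
  · rintro ⟨hi, h⟩ j
    rcases eq_or_ne j i with rfl | hj
    · rw [Finsupp.single_eq_same]
      omega
    · simpa only [Finsupp.single_eq_of_ne hj, tsub_zero] using h j hj

theorem elementary_mul_powerSum {m r : ℕ} (hr : 0 < r) (hrm : r ≤ m) :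
    elementary (m - r) * powerSum r = hookSum r m + hookSum (r + 1) m := by
  classical
  ext d
  rw [coeff_mul_powerSum hr, map_add, coeff_hookSum, coeff_hookSum, ← Finset.sum_add_distrib,
    Finset.sum_filter]
  refine Finset.sum_congr rfl fun i _ => ?_
  rw [coeff_elementary, forall_sub_single_le_one_iff]
  by_cases hi : r ≤ d i
  · have := degree_sub_single hi
    by_cases hrest : d.degree = m ∧ ∀ j, j ≠ i → d j ≤ 1
    · have hdeg : (d - Finsupp.single i r).degree = m - r := by omega
      simp only [hi, hdeg, hrest.1, eq_true hrest.2, if_true, and_true, true_and]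
      split_ifs <;> omega
    · rw [if_pos hi, if_neg, if_neg, if_neg, add_zero]
      exacts [fun h => hrest ⟨h.1, h.2.2⟩, fun h => hrest ⟨h.1, h.2.2⟩,
        fun h => hrest ⟨by omega, h.1.2⟩]
  · rw [if_neg hi, if_neg, if_neg, add_zero] <;> omega

/-- The alternating sum telescopes in the symmetric functions `hookSum r m`. -/
theorem natCast_mul_elementary_eq_sum_powerSum (m : ℕ) :
    (m : PowerSeriesRing) * elementary m =
      ∑ r ∈ Finset.range m, (-1) ^ r * powerSum (r + 1) * elementary (m - (r + 1)) := by
  have hterm : ∀ r ∈ Finset.range m,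
      (-1) ^ r * powerSum (r + 1) * elementary (m - (r + 1)) =
        (-1) ^ r * hookSum (r + 1) m - (-1) ^ (r + 1) * hookSum (r + 1 + 1) m := by
    intro r hr
    rw [mul_assoc, mul_comm (powerSum _),
      elementary_mul_powerSum r.succ_pos (Finset.mem_range.1 hr)]
    ring
  rw [Finset.sum_congr rfl hterm,
    Finset.sum_range_sub' fun r => (-1 : PowerSeriesRing) ^ r * hookSum (r + 1) m,
    hookSum_eq_zero m.lt_succ_self, hookSum_one]
  ring

theorem signedPowerSum_elementary {m : ℕ} (hm : 0 < m) :
    signedPowerSum elementary m = (-1) ^ (m - 1) * powerSum m := by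
  obtain ⟨m, rfl⟩ := Nat.exists_eq_add_of_lt hm
  rw [zero_add, ← eq_signedPowerSum_of_newton elementary_zero
    (p := fun m => (-1) ^ (m - 1) * powerSum m) natCast_mul_elementary_eq_sum_powerSum]

theorem coeff_prod_powerSum {I : Type*} [Fintype I] (s : I → ℕ) (hs : ∀ i, 0 < s i)
    (d : ℕ+ →₀ ℕ) :
    MvPowerSeries.coeff d (∏ i, powerSum (s i)) =
      (Nat.card {f : I → ℕ+ // ∑ i, Finsupp.single (f i) (s i) = d} : ℤ) := by
  classical
  rw [MvPowerSeries.coeff_prod]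
  simp only [coeff_powerSum, Finset.prod_ite_zero, Finset.prod_const_one]
  rw [Finset.sum_boole, Nat.cast_inj, ← Nat.card_eq_finsetCard]
  symm
  refine Nat.card_eq_of_bijective (fun f => ⟨Finsupp.equivFunOnFinite.symm
    (fun i => Finsupp.single (f.1 i) (s i)), ?_⟩) ⟨?_, ?_⟩
  · exact Finset.mem_filter.2
      ⟨Finset.mem_finsuppAntidiag.2 ⟨f.2, Finset.subset_univ _⟩, fun i _ => ⟨f.1 i, rfl⟩⟩
  · intro f f' h
    refine Subtype.ext (funext fun i => ?_)
    exact (Finsupp.single_left_inj (hs i).ne').1 (DFunLike.congr_fun (Subtype.ext_iff.1 h) i)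
  · rintro ⟨l, hl⟩
    obtain ⟨hsum, hsingle⟩ := Finset.mem_filter.1 hl
    choose f hf using fun i => hsingle i (Finset.mem_univ i)
    refine ⟨⟨f, ?_⟩, Subtype.ext (Finsupp.ext hf)⟩
    rw [← (Finset.mem_finsuppAntidiag.1 hsum).1]
    exact Finset.sum_congr rfl fun i _ => hf i

/-! ### The contribution of a tree -/

/-- The decorations that turn a tree with `m` vertices into a tree triple `(T, α, r)`: a composition
`α` of `m` and an integer `1 ≤ r ≤ α₁`, encoded as `r - 1`. -/
abbrev Decoration (m : ℕ) : Type := Σ α : Composition m, Fin (α.blocks.headD 0)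

section TreeWeight

variable {R : Type*} [CommRing R] (e : ℕ → R)

open Classical in
/-- The factor that a decorated tree with `m` vertices contributes to the entry `(i, j)` of the
forest triple matrix; it is `0` if the decoration violates the conditions defining `FT⁽ⁱ⁾(G + P_j)`.
Here `a` says that the tree contains the first vertex of `G`, and `b` that it contains the path. -/
def decorationWeight (i j : ℕ) (a b : Prop) {m : ℕ} (x : Decoration m) : R :=
  if (a → x.1.blocks.headD 0 = i ∧ x.2.val = 0) ∧ (b → j ≤ x.1.blocks.getLastD 0) then
    (-1) ^ (x.1.blocks.length - 1) *
      ((if a then x.1.blocks.tail else x.1.blocks).map e).prod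
  else 0

/-- The total contribution to the entry `(i, j)` of the forest triple matrix of all the decorations
of a tree with `m` vertices. -/
def treeWeight (i j : ℕ) (a b : Prop) (m : ℕ) : R :=
  ∑ x : Decoration m, decorationWeight e i j a b x

variable (i j : ℕ) {a b : Prop}

open Classical in
theorem treeWeight_of_not (ha : ¬ a) (m : ℕ) :
    treeWeight e i j a b m = ∑ l ∈ compositionLists m, if b → j ≤ l.getLastD 0 then
      (-1) ^ (l.length - 1) * (l.headD 0 : R) * (l.map e).prod else 0 := by
  rw [treeWeight, Fintype.sum_sigma, ← sum_composition]
  refine Finset.sum_congr rfl fun α _ => ?_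
  simp only [decorationWeight, ha, false_imp_iff, true_and, if_false, Finset.sum_const,
    Finset.card_univ, Fintype.card_fin, nsmul_eq_mul]
  split_ifs <;> ring

theorem treeWeight_of_not_of_not (ha : ¬ a) (hb : ¬ b) (m : ℕ) :
    treeWeight e i j a b m = signedPowerSum e m := by
  rw [treeWeight_of_not e i j ha, signedPowerSum]
  exact Finset.sum_congr rfl fun l _ => if_pos fun h => absurd h hb

open Classical in
theorem sum_decorationWeight_of_mem (ha : a) {m : ℕ} (α : Composition m) :
    ∑ x : Fin (α.blocks.headD 0), decorationWeight e i j a b ⟨α, x⟩ =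
      if α.blocks.headD 0 = i ∧ 0 < i ∧ (b → j ≤ α.blocks.getLastD 0) then
        (-1) ^ (α.blocks.length - 1) * (α.blocks.tail.map e).prod else 0 := by
  simp only [decorationWeight, eq_true ha, true_imp_iff, if_true]
  split_ifs with h
  · rw [Finset.sum_eq_single (⟨0, by omega⟩ : Fin (α.blocks.headD 0))]
    · exact if_pos ⟨⟨h.1, rfl⟩, h.2.2⟩
    · exact fun x _ hx => if_neg fun hx' => hx (Fin.ext hx'.1.2)
    · exact fun h => absurd (Finset.mem_univ _) h
  · refine Finset.sum_eq_zero fun x _ => if_neg fun hx => h ⟨hx.1.1, ?_, hx.2⟩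
    have := x.isLt
    omega

variable {i}

open Classical in
theorem treeWeight_of_mem (hi : 0 < i) (ha : a) (m : ℕ) :
    treeWeight e i j a b m = if i ≤ m then
      ∑ l ∈ compositionLists (m - i), if b → j ≤ (i :: l).getLastD 0 then
        (-1) ^ l.length * (l.map e).prod else 0 else 0 := by
  rw [treeWeight, Fintype.sum_sigma,
    Finset.sum_congr rfl fun α _ => sum_decorationWeight_of_mem e i j ha α,
    sum_composition fun l => if l.headD 0 = i ∧ 0 < i ∧ (b → j ≤ l.getLastD 0) then
      (-1) ^ (l.length - 1) * (l.tail.map e).prod else 0]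
  rcases Nat.eq_zero_or_pos m with rfl | hm
  · rw [if_neg (by omega), compositionLists_zero, Finset.sum_singleton, if_neg]
    exact fun h => hi.ne h.1
  rw [sum_compositionLists_cons hm]
  simp only [List.headD_cons, List.tail_cons, List.length_cons, Nat.add_sub_cancel]
  split_ifs with him
  · rw [Finset.sum_eq_single i]
    · simp only [hi, true_and]
    · exact fun k _ hk => Finset.sum_eq_zero fun l _ => if_neg fun h => hk h.1
    · exact fun h => absurd (Finset.mem_Icc.2 ⟨hi, him⟩) h
  · refine Finset.sum_eq_zero fun k hk => Finset.sum_eq_zero fun l _ => if_neg fun h => him ?_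
    exact h.1 ▸ (Finset.mem_Icc.1 hk).2

theorem treeWeight_of_mem_of_not (hi : 0 < i) (ha : a) (hb : ¬ b) (m : ℕ) :
    treeWeight e i j a b m = if i ≤ m then signedComplete e (m - i) else 0 := by
  rw [treeWeight_of_mem e j hi ha]
  refine if_congr Iff.rfl (Finset.sum_congr rfl fun l _ => if_pos fun h => absurd h hb) rfl

theorem sum_compositionLists_signedPowerSum_concat {m s : ℕ} (hs : s ≤ m) :
    ∑ l ∈ compositionLists (m - s), (-1) ^ ((l ++ [s]).length - 1) * ((l ++ [s]).headD 0 : R) *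
        ((l ++ [s]).map e).prod =
      (if s = m then (m : R) * e m else 0) - e s * signedPowerSum e (m - s) := by
  split_ifs with hsm
  · subst hsm
    simp [compositionLists_zero, signedPowerSum_zero]
  · rw [signedPowerSum, Finset.mul_sum, zero_sub, ← Finset.sum_neg_distrib]
    refine Finset.sum_congr rfl fun l hl => ?_
    cases l with
    | nil => exact absurd (nil_mem_compositionLists.1 hl) (by omega)
    | cons c l =>
      simp only [List.cons_append, List.length_cons, List.length_append, List.headD_cons,
        List.map_cons, List.map_append, List.prod_cons, List.prod_append, List.map_nil,
        List.prod_nil, List.length_nil, Nat.add_sub_cancel, zero_add, pow_succ]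
      ring

variable {e}

theorem treeWeight_of_not_of_mem (he : e 0 = 1) (i : ℕ) {k m : ℕ} (ha : ¬ a) (hb : b)
    (hkm : k + 1 ≤ m) :
    treeWeight e i (k + 1) a b m =
      ∑ s ∈ Finset.range (k + 1), e s * signedPowerSum e (m - s) := by
  classical
  have hterm : ∀ s ∈ Finset.Icc 1 m, (∑ l ∈ compositionLists (m - s),
      if b → k + 1 ≤ (l ++ [s]).getLastD 0 then (-1) ^ ((l ++ [s]).length - 1) *
        ((l ++ [s]).headD 0 : R) * ((l ++ [s]).map e).prod else 0) =
      if k + 1 ≤ s then (if s = m then (m : R) * e m else 0) - e s * signedPowerSum e (m - s)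
        else 0 := by
    intro s hs
    simp only [List.getLastD_concat, eq_true hb, true_imp_iff]
    by_cases hks : k + 1 ≤ s
    · simp only [if_pos hks, sum_compositionLists_signedPowerSum_concat e (Finset.mem_Icc.1 hs).2]
    · simp only [if_neg hks, Finset.sum_const_zero]
  have hfilter : {s ∈ Finset.Icc 1 m | k + 1 ≤ s} = Finset.Ico (k + 1) (m + 1) := by
    ext s
    simp only [Finset.mem_filter, Finset.mem_Icc, Finset.mem_Ico]
    omega
  rw [treeWeight_of_not e i (k + 1) ha, sum_compositionLists_concat (by omega),
    Finset.sum_congr rfl hterm, ← Finset.sum_filter, hfilter, Finset.sum_sub_distrib,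
    Finset.sum_ite_eq', if_pos (Finset.mem_Ico.2 ⟨hkm, m.lt_succ_self⟩),
    natCast_mul_eq_sum_signedPowerSum he, Finset.sum_Ico_succ_top hkm, Nat.sub_self,
    signedPowerSum_zero, mul_zero, add_zero, ← Finset.sum_range_add_sum_Ico _ hkm,
    add_sub_cancel_right]

variable (e) in
theorem treeWeight_of_mem_of_mem {k c : ℕ} (ha : a) (hb : b) (hc : 0 < c) :
    treeWeight e (k + 1) (k + 1) a b (k + 1 + c) =
      -∑ s ∈ Finset.Icc 1 c, if k < s then e s * signedComplete e (c - s) else 0 := by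
  classical
  rw [treeWeight_of_mem e (k + 1) k.succ_pos ha, if_pos (by omega), Nat.add_sub_cancel_left,
    sum_compositionLists_concat hc, ← Finset.sum_neg_distrib]
  refine Finset.sum_congr rfl fun s _ => ?_
  simp only [eq_true hb, true_imp_iff, ← List.cons_append, List.getLastD_concat, Nat.succ_le_iff]
  split_ifs with h
  · rw [signedComplete, Finset.mul_sum, ← Finset.sum_neg_distrib]
    refine Finset.sum_congr rfl fun l _ => ?_
    rw [List.map_append, List.prod_append, List.map_singleton, List.prod_singleton,
      List.length_append, List.length_singleton, pow_succ]
    ring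
  · rw [Finset.sum_const_zero, neg_zero]

/-- With `E`, `P`, `H` the generating functions of `e`, of the shifted power sums and of the signed
complete functions, the sum is a coefficient of `(E * P) * H = P`. -/
theorem sum_treeWeight_mul_treeWeight (he : e 0 = 1) {s t N : ℕ} (hs : 0 < s) (ht : 0 < t)
    (hN : s ≤ N) {a₁ b₁ a₂ b₂ : Prop} (ha₁ : a₁) (hb₁ : ¬ b₁) (ha₂ : ¬ a₂) (hb₂ : b₂) :
    ∑ k ∈ Finset.range N, treeWeight e (k + 1) (k + 1) a₁ b₁ s *
      treeWeight e (k + 1) (k + 1) a₂ b₂ (t + k) = signedPowerSum e (s + t - 1) := by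
  have hcancel : PowerSeries.mk (fun k => ∑ u ∈ Finset.range (k + 1),
      e u * signedPowerSum e (t + (k - u))) * PowerSeries.mk (signedComplete e) =
        PowerSeries.mk fun u => signedPowerSum e (t + u) := by
    have hEP : PowerSeries.mk (fun k => ∑ u ∈ Finset.range (k + 1),
        e u * signedPowerSum e (t + (k - u))) =
          PowerSeries.mk e * PowerSeries.mk fun u => signedPowerSum e (t + u) := by
      ext k
      rw [coeff_mk_mul_mk, PowerSeries.coeff_mk]
    rw [hEP, mul_right_comm, mk_mul_mk_signedComplete he, one_mul]
  have hcoeff := congrArg (PowerSeries.coeff (s - 1)) hcancel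
  rw [coeff_mk_mul_mk, PowerSeries.coeff_mk, Nat.sub_add_cancel hs] at hcoeff
  rw [show s + t - 1 = t + (s - 1) by omega, ← hcoeff]
  symm
  refine Finset.sum_subset_zero_on_sdiff (Finset.range_subset_range.2 hN) (fun k hk => ?_)
    fun k hk => ?_
  · rw [Finset.mem_sdiff, Finset.mem_range, Finset.mem_range] at hk
    rw [treeWeight_of_mem_of_not e _ k.succ_pos ha₁ hb₁, if_neg (by omega), zero_mul]
  · have hks := Finset.mem_range.1 hk
    rw [treeWeight_of_mem_of_not e _ k.succ_pos ha₁ hb₁, if_pos (by omega),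
      treeWeight_of_not_of_mem he _ ha₂ hb₂ (by omega), mul_comm,
      show s - 1 - k = s - (k + 1) by omega]
    congr 1
    refine Finset.sum_congr rfl fun u hu => ?_
    rw [Nat.add_sub_assoc (Nat.lt_succ_iff.1 (Finset.mem_range.1 hu))]

variable (e) in
theorem sum_treeWeight {c N : ℕ} (hc : 0 < c) (hN : c ≤ N) (ha : a) (hb : b) :
    ∑ k ∈ Finset.range N, treeWeight e (k + 1) (k + 1) a b (k + 1 + c) = -signedPowerSum e c := by
  rw [Finset.sum_congr rfl fun k _ => treeWeight_of_mem_of_mem e ha hb hc, Finset.sum_neg_distrib,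
    Finset.sum_comm, signedPowerSum_eq]
  congr 1
  refine Finset.sum_congr rfl fun s hs => ?_
  have hsN := (Finset.mem_Icc.1 hs).2.trans hN
  have hfilter : {k ∈ Finset.range N | k < s} = Finset.range s := by
    ext k
    simp only [Finset.mem_filter, Finset.mem_range]
    omega
  rw [← Finset.sum_filter, hfilter, Finset.sum_const, Finset.card_range, nsmul_eq_mul, mul_assoc]

end TreeWeight

/-! ### Connected components of edge sets -/

section Components

variable {V : Type*} {S T : Set (Sym2 V)} {u v : V}

/-- The partition of the vertices into the connected components of the graph with edge set `S`.
As a setoid, it can be compared with the kernel of a colouring. -/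
def componentSetoid (S : Set (Sym2 V)) : Setoid V :=
  (SimpleGraph.fromEdgeSet S).reachableSetoid

theorem componentSetoid_le_iff {r : Setoid V} :
    componentSetoid S ≤ r ↔ ∀ a b, s(a, b) ∈ S → r a b := by
  constructor
  · intro h a b hab
    rcases eq_or_ne a b with rfl | hne
    · exact r.refl a
    · exact h (SimpleGraph.Adj.reachable ((SimpleGraph.fromEdgeSet_adj S).2 ⟨hab, hne⟩))
  · rintro h a b ⟨p⟩
    induction p with
    | nil => exact r.refl _
    | cons hadj _ ih => exact r.trans (h _ _ ((SimpleGraph.fromEdgeSet_adj S).1 hadj).1) ih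

theorem componentSetoid_of_mem {a b : V} (h : s(a, b) ∈ S) : componentSetoid S a b :=
  componentSetoid_le_iff.1 le_rfl a b h

theorem componentSetoid_mono (h : S ⊆ T) : componentSetoid S ≤ componentSetoid T :=
  componentSetoid_le_iff.2 fun _ _ hab => componentSetoid_of_mem (h hab)

theorem componentSetoid_sdiff_singleton (h : componentSetoid (S \ {s(u, v)}) u v) :
    componentSetoid (S \ {s(u, v)}) = componentSetoid S := by
  refine le_antisymm (componentSetoid_mono Set.sdiff_subset) (componentSetoid_le_iff.2 ?_)
  intro a b hab
  by_cases he : s(a, b) = s(u, v)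
  · rcases Sym2.eq_iff.1 he with ⟨rfl, rfl⟩ | ⟨rfl, rfl⟩
    exacts [h, Setoid.symm' _ h]
  · exact componentSetoid_of_mem ⟨hab, he⟩

theorem componentSetoid_congr_of_sdiff_singleton (hST : S \ {s(u, v)} = T \ {s(u, v)})
    (h : componentSetoid (S \ {s(u, v)}) u v) : componentSetoid S = componentSetoid T := by
  rw [← componentSetoid_sdiff_singleton h, hST]
  rw [hST] at h
  exact componentSetoid_sdiff_singleton h

theorem mem_of_mem_edges_fromEdgeSet {c : (SimpleGraph.fromEdgeSet S).Walk u v} {f : Sym2 V}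
    (hf : f ∈ c.edges) : f ∈ S :=
  (SimpleGraph.edgeSet_fromEdgeSet S ▸ c.edges_subset_edgeSet hf).1

end Components

/-! ### Whitney's broken circuit theorem -/

section Edges

variable {V : Type*} [Finite V] {G : SimpleGraph V}

/-- The edges of a finite graph, as a finset that does not depend on any decidability instance. -/
def edges (G : SimpleGraph V) : Finset (Sym2 V) :=
  G.edgeSet.toFinite.toFinset

theorem mem_edges {e : Sym2 V} : e ∈ edges G ↔ e ∈ G.edgeSet :=
  Set.Finite.mem_toFinset _

theorem coe_subset_edgeSet {S : Finset (Sym2 V)} (h : S ⊆ edges G) :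
    (S : Set (Sym2 V)) ⊆ G.edgeSet :=
  fun _ he => mem_edges.1 (h he)

end Edges

section ActiveEdges

variable {V : Type*} {G : SimpleGraph V} {o : LinearOrder G.edgeSet} {S T : Set (Sym2 V)}
  {e : G.edgeSet}

/-- The edges of `S` that are smaller than the edge `e` of `G`. The order is an explicit argument,
since `G.edgeSet` also inherits an order from `Sym2 V`. -/
def edgesBelow (o : LinearOrder G.edgeSet) (S : Set (Sym2 V)) (e : G.edgeSet) : Set (Sym2 V) :=
  {f | f ∈ S ∧ ∃ h : f ∈ G.edgeSet, o.lt ⟨f, h⟩ e}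

/-- The edges of `G` whose ends are connected by smaller edges of `S`: these are the largest edges
of the cycles whose broken circuits are contained in `S`. -/
def activeEdges (o : LinearOrder G.edgeSet) (S : Set (Sym2 V)) : Set G.edgeSet :=
  {e | ∃ u v, e.val = s(u, v) ∧ componentSetoid (edgesBelow o S e) u v}

theorem edgesBelow_subset (o : LinearOrder G.edgeSet) (S : Set (Sym2 V)) (e : G.edgeSet) :
    edgesBelow o S e ⊆ S \ {e.val} := by
  rintro f ⟨hf, h, hlt⟩
  refine ⟨hf, ?_⟩
  rintro rfl
  exact @lt_irrefl _ o.toPreorder _ hlt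

theorem edgesBelow_subset_edgeSet (o : LinearOrder G.edgeSet) (S : Set (Sym2 V)) (e : G.edgeSet) :
    edgesBelow o S e ⊆ G.edgeSet :=
  fun _ hf => hf.2.1

theorem edgesBelow_sdiff_singleton (o : LinearOrder G.edgeSet) (S : Set (Sym2 V))
    (e : G.edgeSet) (f : Sym2 V) :
    edgesBelow o S e \ {f} = edgesBelow o (S \ {f}) e :=
  Set.ext fun _ => ⟨fun h => ⟨⟨h.1.1, h.2⟩, h.1.2⟩, fun h => ⟨⟨h.1.1, h.2⟩, h.1.2⟩⟩

theorem edgesBelow_mono (o : LinearOrder G.edgeSet) (h : S ⊆ T) (e : G.edgeSet) :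
    edgesBelow o S e ⊆ edgesBelow o T e :=
  fun _ hf => ⟨h hf.1, hf.2⟩

theorem edgesBelow_sdiff_singleton_of_le {e' : G.edgeSet} (h : o.le e' e) :
    edgesBelow o (S \ {e.val}) e' = edgesBelow o S e' := by
  refine (edgesBelow_mono o Set.sdiff_subset e').antisymm fun f hf => ⟨⟨hf.1, ?_⟩, hf.2⟩
  rintro rfl
  exact @not_lt_of_ge _ o.toPreorder _ _ h hf.2.2

theorem componentSetoid_eq_of_mem_activeEdges (he : e ∈ activeEdges o S)
    (hST : S \ {e.val} = T \ {e.val}) : componentSetoid S = componentSetoid T := by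
  obtain ⟨u, v, huv, h⟩ := he
  have hbelow := edgesBelow_subset o S e
  rw [huv] at hST hbelow
  exact componentSetoid_congr_of_sdiff_singleton hST (componentSetoid_mono hbelow h)

theorem componentSetoid_edgesBelow_eq (he : e ∈ activeEdges o S)
    (hST : S \ {e.val} = T \ {e.val}) (e' : G.edgeSet) :
    componentSetoid (edgesBelow o S e') = componentSetoid (edgesBelow o T e') := by
  rcases @le_or_gt _ o e' e with hle | hlt
  · rw [← edgesBelow_sdiff_singleton_of_le (S := S) hle, hST, edgesBelow_sdiff_singleton_of_le hle]
  · obtain ⟨u, v, huv, h⟩ := he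
    have hbelow : edgesBelow o S e ⊆ edgesBelow o S e' \ {e.val} := fun f hf =>
      ⟨⟨hf.1, hf.2.1, @lt_trans _ o.toPreorder _ _ _ hf.2.2 hlt⟩, (edgesBelow_subset o S e hf).2⟩
    rw [huv] at hST hbelow
    refine componentSetoid_congr_of_sdiff_singleton ?_ (componentSetoid_mono hbelow h)
    rw [edgesBelow_sdiff_singleton, hST, edgesBelow_sdiff_singleton]

theorem activeEdges_eq_of_mem_activeEdges (he : e ∈ activeEdges o S)
    (hST : S \ {e.val} = T \ {e.val}) :
    activeEdges o S = activeEdges o T := by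
  ext e'
  change (∃ u v, _ ∧ _) ↔ ∃ u v, _ ∧ _
  rw [componentSetoid_edgesBelow_eq he hST e']

section Toggle

variable {α : Type*} [DecidableEq α]

theorem coe_symmDiff_singleton_sdiff (S : Finset α) (a : α) :
    ((symmDiff S {a} : Finset α) : Set α) \ {a} = (S : Set α) \ {a} := by
  ext b
  rcases eq_or_ne b a with rfl | hb <;> simp [*]

theorem symmDiff_singleton_ne (S : Finset α) (a : α) : symmDiff S {a} ≠ S := by
  rw [Ne, symmDiff_eq_left, Finset.bot_eq_empty]
  exact Finset.singleton_ne_empty a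

theorem neg_one_pow_card_symmDiff_singleton {R : Type*} [Ring R] (S : Finset α) (a : α) :
    (-1 : R) ^ (symmDiff S {a}).card = -(-1) ^ S.card := by
  by_cases ha : a ∈ S
  · have hS : symmDiff S {a} = S.erase a := by
      ext b
      rcases eq_or_ne b a with rfl | hb <;> simp [Finset.mem_symmDiff, *]
    rw [hS, ← Finset.card_erase_add_one ha, pow_succ, mul_neg_one, neg_neg]
  · have hS : symmDiff S {a} = insert a S := by
      ext b
      rcases eq_or_ne b a with rfl | hb <;> simp [Finset.mem_symmDiff, *]
    rw [hS, Finset.card_insert_of_notMem ha, pow_succ, mul_neg_one]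

end Toggle

open Classical in
/-- Toggling an active edge changes neither the components nor the active edges, so that choosing
the edge by the set of active edges gives a sign-reversing involution. -/
theorem sum_filter_activeEdges_nonempty_eq_zero [Finite V] {R : Type*} [CommRing R]
    (o : LinearOrder G.edgeSet) (φ : Setoid V → R) :
    ∑ S ∈ (edges G).powerset.filter fun S : Finset (Sym2 V) =>
      (activeEdges o (S : Set (Sym2 V))).Nonempty, (-1) ^ S.card * φ (componentSetoid S) = 0 := by
  rcases isEmpty_or_nonempty G.edgeSet with hG | hG
  · refine Finset.sum_eq_zero fun S hS => ?_
    obtain ⟨e, -⟩ := (Finset.mem_filter.1 hS).2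
    exact isEmptyElim e
  choose! pick hpick using fun (A : Set G.edgeSet) (hA : A.Nonempty) => hA
  set toggle : Finset (Sym2 V) → Finset (Sym2 V) := fun S =>
    symmDiff S {(pick (activeEdges o S)).val} with htoggle
  have hcomponents : ∀ S ∈ (edges G).powerset.filter fun S : Finset (Sym2 V) =>
      (activeEdges o (S : Set (Sym2 V))).Nonempty,
      componentSetoid (toggle S : Set (Sym2 V)) = componentSetoid S := fun S hS =>
    (componentSetoid_eq_of_mem_activeEdges (hpick _ (Finset.mem_filter.1 hS).2)
      (coe_symmDiff_singleton_sdiff S _).symm).symm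
  have hactive : ∀ S ∈ (edges G).powerset.filter fun S : Finset (Sym2 V) =>
      (activeEdges o (S : Set (Sym2 V))).Nonempty,
      activeEdges o (toggle S : Set (Sym2 V)) = activeEdges o S := fun S hS =>
    (activeEdges_eq_of_mem_activeEdges (hpick _ (Finset.mem_filter.1 hS).2)
      (coe_symmDiff_singleton_sdiff S _).symm).symm
  refine Finset.sum_involution (fun S _ => toggle S) ?_ ?_ ?_ ?_
  · intro S hS
    rw [hcomponents S hS, htoggle, neg_one_pow_card_symmDiff_singleton]
    ring
  · exact fun S _ _ => symmDiff_singleton_ne S _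
  · intro S hS
    rw [Finset.mem_filter, hactive S hS]
    refine ⟨Finset.mem_powerset.2 fun f hf => ?_, (Finset.mem_filter.1 hS).2⟩
    rcases Finset.mem_symmDiff.1 hf with h | h
    · exact Finset.mem_powerset.1 (Finset.mem_filter.1 hS).1 h.1
    · rw [Finset.mem_singleton.1 h.1]
      exact mem_edges.2 (pick _).2
  · intro S hS
    change symmDiff (toggle S) {(pick (activeEdges o (toggle S))).val} = S
    rw [hactive S hS, htoggle, symmDiff_symmDiff_cancel_right]

end ActiveEdges

section Whitney

variable {N : ℕ} {G : SimpleGraph (Fin N)}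

/-- The edge set `S` contains no broken circuit, with respect to the order `o` of the edges. -/
def NoBrokenCircuit (G : SimpleGraph (Fin N)) (o : LinearOrder G.edgeSet)
    (S : Set (Sym2 (Fin N))) : Prop :=
  ∀ B, IsBrokenCircuit G o B → ¬ B ⊆ S

variable {o : LinearOrder G.edgeSet} {S : Set (Sym2 (Fin N))}

theorem isBrokenCircuit_of_isCycle (hS : S ⊆ G.edgeSet) {w : Fin N}
    {c : (SimpleGraph.fromEdgeSet S).Walk w w} (hc : c.IsCycle) {e : G.edgeSet}
    (he : e.val ∈ c.edges) (hmax : ∀ f : G.edgeSet, f.val ∈ c.edges → o.le f e) :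
    IsBrokenCircuit G o ({f | f ∈ c.edges} \ {e.val}) := by
  have hcG : ∀ f ∈ c.edges, f ∈ G.edgeSet := fun f hf =>
    hS (mem_of_mem_edges_fromEdgeSet hf)
  refine ⟨w, c.transfer G hcG, e, hc.transfer hcG, ?_, fun f hf => hmax f ?_, ?_⟩
  · rwa [SimpleGraph.Walk.edges_transfer]
  · rwa [SimpleGraph.Walk.edges_transfer] at hf
  · rw [SimpleGraph.Walk.edges_transfer]

theorem exists_isBrokenCircuit_subset {e : G.edgeSet} (he : e ∈ activeEdges o S) :
    ∃ B, IsBrokenCircuit G o B ∧ B ⊆ S := by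
  obtain ⟨u, v, huv, hreach⟩ := he
  set K := SimpleGraph.fromEdgeSet (insert e.val (edgesBelow o S e))
  have huvK : K.Adj u v := (SimpleGraph.fromEdgeSet_adj _).2
    ⟨huv ▸ Set.mem_insert _ _, G.ne_of_adj (G.mem_edgeSet.1 (huv ▸ e.2))⟩
  have hdelete : (K \ SimpleGraph.fromEdgeSet {s(u, v)}).Reachable u v := by
    refine SimpleGraph.Reachable.mono (fun a b hab => ?_) hreach
    obtain ⟨hab, hne⟩ := (SimpleGraph.fromEdgeSet_adj _).1 hab
    refine ⟨(SimpleGraph.fromEdgeSet_adj _).2 ⟨Set.mem_insert_of_mem _ hab, hne⟩, fun h => ?_⟩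
    exact (edgesBelow_subset o S e hab).2 (huv ▸ ((SimpleGraph.fromEdgeSet_adj _).1 h).1)
  obtain ⟨w, c, hc, hec⟩ :=
    SimpleGraph.adj_and_reachable_delete_edges_iff_exists_cycle.1 ⟨huvK, hdelete⟩
  have hK : insert e.val (edgesBelow o S e) ⊆ G.edgeSet :=
    Set.insert_subset e.2 (edgesBelow_subset_edgeSet o S e)
  refine ⟨_, isBrokenCircuit_of_isCycle hK hc (huv ▸ hec) fun f hf => ?_, fun f hf => ?_⟩
  · rcases mem_of_mem_edges_fromEdgeSet hf with h | ⟨_, _, hlt⟩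
    · exact (Subtype.ext h : f = e) ▸ o.le_refl f
    · exact @le_of_lt _ o.toPreorder _ _ hlt
  · exact ((mem_of_mem_edges_fromEdgeSet hf.1).resolve_left hf.2).1

theorem activeEdges_nonempty_of_isBrokenCircuit {B : Set (Sym2 (Fin N))}
    (hB : IsBrokenCircuit G o B) (hBS : B ⊆ S) :
    (activeEdges o S).Nonempty := by
  obtain ⟨w, c, e, hc, hec, hmax, rfl⟩ := hB
  obtain ⟨⟨u, v⟩, huv⟩ : ∃ p : Fin N × Fin N, s(p.1, p.2) = e.val := ⟨_, Quot.out_eq e.val⟩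
  refine ⟨e, u, v, huv.symm, ?_⟩
  set K := SimpleGraph.fromEdgeSet {f | f ∈ c.edges}
  have hcK : ∀ f ∈ c.edges, f ∈ K.edgeSet := fun f hf =>
    (SimpleGraph.edgeSet_fromEdgeSet _).symm ▸
      ⟨hf, G.not_isDiag_of_mem_edgeSet (c.edges_subset_edgeSet hf)⟩
  have hreach := (SimpleGraph.adj_and_reachable_delete_edges_iff_exists_cycle.2
    ⟨w, c.transfer K hcK, hc.transfer hcK, by rwa [SimpleGraph.Walk.edges_transfer, huv]⟩).2
  refine SimpleGraph.Reachable.mono (fun a b hab => ?_) hreach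
  rw [SimpleGraph.deleteEdges_adj, SimpleGraph.fromEdgeSet_adj] at hab
  obtain ⟨⟨hmem, hne⟩, hdel⟩ := hab
  have habe : s(a, b) ≠ e.val := fun h => hdel (h.trans huv.symm)
  have habG : s(a, b) ∈ G.edgeSet := c.edges_subset_edgeSet hmem
  refine (SimpleGraph.fromEdgeSet_adj _).2 ⟨⟨hBS ⟨hmem, habe⟩, habG, ?_⟩, hne⟩
  exact @lt_of_le_of_ne _ o.toPartialOrder _ _ (hmax ⟨_, habG⟩ hmem)
    fun h => habe (Subtype.ext_iff.1 h)

theorem not_noBrokenCircuit_iff :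
    ¬ NoBrokenCircuit G o S ↔ (activeEdges o S).Nonempty := by
  simp only [NoBrokenCircuit, not_forall, not_not, exists_prop]
  exact ⟨fun ⟨_, hB, hBS⟩ => activeEdges_nonempty_of_isBrokenCircuit hB hBS,
    fun ⟨_, he⟩ => exists_isBrokenCircuit_subset he⟩

theorem NoBrokenCircuit.isAcyclic (h : NoBrokenCircuit G o S)
    (hS : S ⊆ G.edgeSet) : (SimpleGraph.fromEdgeSet S).IsAcyclic := by
  intro w c hc
  have hne : {f : G.edgeSet | f.val ∈ c.edges}.Nonempty := by
    obtain ⟨f, hf⟩ : ∃ f, f ∈ c.edges := List.exists_mem_of_length_pos <| by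
      rw [SimpleGraph.Walk.length_edges]
      exact three_pos.trans_le hc.three_le_length
    exact ⟨⟨f, hS (mem_of_mem_edges_fromEdgeSet hf)⟩, hf⟩
  obtain ⟨e, he, hmax⟩ := @Set.exists_max_image _ _ o _ id (Set.toFinite _) hne
  exact h _ (isBrokenCircuit_of_isCycle hS hc he hmax)
    fun f hf => mem_of_mem_edges_fromEdgeSet hf.1

open Classical in
/-- The edge sets of `G` without broken circuits. -/
def noBrokenCircuitSets (G : SimpleGraph (Fin N)) (o : LinearOrder G.edgeSet) :
    Finset (Finset (Sym2 (Fin N))) :=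
  (edges G).powerset.filter fun S => NoBrokenCircuit G o (S : Set (Sym2 (Fin N)))

theorem mem_noBrokenCircuitSets {S : Finset (Sym2 (Fin N))} :
    S ∈ noBrokenCircuitSets G o ↔
      S ⊆ edges G ∧ NoBrokenCircuit G o (S : Set (Sym2 (Fin N))) := by
  simp [noBrokenCircuitSets]

theorem sum_powerset_eq_sum_noBrokenCircuit {R : Type*} [CommRing R] (o : LinearOrder G.edgeSet)
    (φ : Setoid (Fin N) → R) :
    ∑ S ∈ (edges G).powerset, (-1) ^ S.card * φ (componentSetoid S) =
      ∑ S ∈ noBrokenCircuitSets G o, (-1) ^ S.card * φ (componentSetoid S) := by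
  classical
  rw [← Finset.sum_filter_add_sum_filter_not _
      fun S : Finset (Sym2 (Fin N)) => NoBrokenCircuit G o S,
    Finset.filter_congr fun S _ => not_noBrokenCircuit_iff,
    sum_filter_activeEdges_nonempty_eq_zero, add_zero, noBrokenCircuitSets]

end Whitney

/-! ### Forest triples as decorated edge sets -/

section Classes

variable {V : Type*}

/-- The number of elements of an equivalence class. -/
def classSize {r : Setoid V} (C : Quotient r) : ℕ := {v | Quotient.mk r v = C}.ncard

instance [Finite V] (r : Setoid V) : Fintype (Quotient r) := Fintype.ofFinite _

theorem sum_classSize [Finite V] (r : Setoid V) : ∑ C : Quotient r, classSize C = Nat.card V :=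
  Nat.card_sigma.symm.trans (Nat.card_congr (Equiv.sigmaFiberEquiv (Quotient.mk r)))

theorem classSize_pos [Finite V] {r : Setoid V} (C : Quotient r) : 0 < classSize C := by
  obtain ⟨v, hv⟩ := Quotient.exists_rep C
  exact (Set.ncard_pos (Set.toFinite _)).2 ⟨v, hv⟩

variable [Fintype V] [LinearOrder V] {r : Setoid V}

open Classical in
/-- The smallest elements of the equivalence classes. -/
def minimalReps (r : Setoid V) : Finset V :=
  Finset.univ.filter fun v => ∀ w, r v w → v ≤ w

theorem mem_minimalReps {v : V} : v ∈ minimalReps r ↔ ∀ w, r v w → v ≤ w := by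
  simp [minimalReps]

theorem exists_minimalRep (C : Quotient r) : ∃ v ∈ minimalReps r, Quotient.mk r v = C := by
  obtain ⟨v, hv⟩ := Quotient.exists_rep C
  obtain ⟨w, hw, hmin⟩ := Set.exists_min_image {w | Quotient.mk r w = C} id (Set.toFinite _) ⟨v, hv⟩
  exact ⟨w, mem_minimalReps.2 fun u hu => hmin u ((Quotient.sound hu).symm.trans hw), hw⟩

theorem minimalReps_injOn : Set.InjOn (Quotient.mk r) (minimalReps r : Set V) :=
  fun _ hv _ hw h => le_antisymm (mem_minimalReps.1 hv _ (Quotient.exact h))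
    (mem_minimalReps.1 hw _ (r.symm (Quotient.exact h)))

theorem sum_map_sort_minimalReps {M : Type*} [AddCommMonoid M] (f : Quotient r → M) :
    (((minimalReps r).sort (· ≤ ·)).map fun v => f (Quotient.mk r v)).sum = ∑ C, f C := by
  rw [← Multiset.sum_coe, ← Multiset.map_coe, Finset.sort_eq]
  exact Finset.sum_bij (fun v _ => Quotient.mk r v) (fun _ _ => Finset.mem_univ _)
    (fun _ hv _ hw h => minimalReps_injOn hv hw h)
    (fun C _ => (exists_minimalRep C).imp fun _ h => ⟨h.1, h.2⟩) fun _ _ => rfl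

end Classes

section ComponentTree

variable {N : ℕ} {G : SimpleGraph (Fin N)} {o : LinearOrder G.edgeSet} {S : Set (Sym2 (Fin N))}

/-- The component `C` of the edge set `S`, as a subgraph. -/
def componentTree (S : Set (Sym2 (Fin N))) (hS : S ⊆ G.edgeSet)
    (C : Quotient (componentSetoid S)) : G.Subgraph where
  verts := {v | Quotient.mk _ v = C}
  Adj a b := s(a, b) ∈ S ∧ Quotient.mk (componentSetoid S) a = C
  adj_sub h := hS h.1
  edge_vert h := h.2
  symm := ⟨fun a b h => ⟨Sym2.eq_swap (a := a) (b := b) ▸ h.1,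
    (Quotient.sound (componentSetoid_of_mem h.1)).symm.trans h.2⟩⟩

theorem componentTree_connected (hS : S ⊆ G.edgeSet) (C : Quotient (componentSetoid S)) :
    (componentTree S hS C).coe.Connected := by
  obtain ⟨v, hv⟩ := Quotient.exists_rep C
  have : Nonempty (componentTree S hS C).verts := ⟨⟨v, hv⟩⟩
  refine SimpleGraph.Connected.mk ?_
  rintro ⟨a, ha⟩ ⟨b, hb⟩
  obtain ⟨p⟩ : componentSetoid S a b := Quotient.exact (Eq.trans ha (Eq.symm hb))
  induction p with
  | nil => exact SimpleGraph.Reachable.refl _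
  | @cons a c b hadj _ ih =>
    have hac : s(a, c) ∈ S := ((SimpleGraph.fromEdgeSet_adj S).1 hadj).1
    have hc : Quotient.mk (componentSetoid S) c = C :=
      (Quotient.sound (componentSetoid_of_mem hac)).symm.trans ha
    have hadj' : (componentTree S hS C).coe.Adj ⟨a, ha⟩ ⟨c, hc⟩ := ⟨hac, ha⟩
    exact hadj'.reachable.trans (ih hc hb)

theorem componentTree_isTree (hS : S ⊆ G.edgeSet)
    (hacyclic : (SimpleGraph.fromEdgeSet S).IsAcyclic) (C : Quotient (componentSetoid S)) :
    (componentTree S hS C).coe.IsTree := by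
  refine ⟨componentTree_connected hS C, ?_⟩
  refine SimpleGraph.IsAcyclic.comap (G' := SimpleGraph.fromEdgeSet S)
    ⟨Subtype.val, fun {a b} h => ?_⟩ Subtype.val_injective hacyclic
  exact (SimpleGraph.fromEdgeSet_adj S).2 ⟨h.1, (hS h.1).ne⟩

theorem mem_edgeSet_componentTree (hS : S ⊆ G.edgeSet) {C : Quotient (componentSetoid S)}
    {e : Sym2 (Fin N)} :
    e ∈ (componentTree S hS C).edgeSet ↔ e ∈ S ∧ Quotient.mk _ (Quot.out e).1 = C := by
  have he : s((Quot.out e).1, (Quot.out e).2) = e := Quot.out_eq e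
  rw [← he, SimpleGraph.Subgraph.mem_edgeSet, he]
  exact Iff.of_eq (congrArg (· ∧ _) (congrArg (· ∈ S) he))

theorem card_add_card_quotient {S : Finset (Sym2 (Fin N))}
    (hS : (S : Set (Sym2 (Fin N))) ⊆ G.edgeSet)
    (hacyclic : (SimpleGraph.fromEdgeSet (S : Set (Sym2 (Fin N)))).IsAcyclic) :
    S.card + Fintype.card (Quotient (componentSetoid (S : Set (Sym2 (Fin N))))) = N := by
  classical
  set r := componentSetoid (S : Set (Sym2 (Fin N)))
  have htree (C : Quotient r) :
      (S.filter fun e => Quotient.mk r (Quot.out e).1 = C).card + 1 = classSize C := by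
    have hcard := (SimpleGraph.isTree_iff_connected_and_card.1
      (componentTree_isTree hS hacyclic C)).2
    rw [← Set.ncard_coe_finset, ← show _ = classSize C from hcard, Nat.card_coe_set_eq,
      ← Set.ncard_image_of_injective _ (Sym2.map.injective Subtype.val_injective),
      SimpleGraph.Subgraph.image_coe_edgeSet_coe]
    congr 2
    ext e
    rw [mem_edgeSet_componentTree, Finset.mem_coe, Finset.mem_filter, Finset.mem_coe]
  rw [Finset.card_eq_sum_card_fiberwise (f := fun e => Quotient.mk r (Quot.out e).1)
      (t := Finset.univ) fun _ _ => Finset.mem_univ _,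
    ← Finset.card_univ, Finset.card_eq_sum_ones, ← Finset.sum_add_distrib,
    Finset.sum_congr rfl fun C _ => htree C, sum_classSize, Nat.card_fin]

theorem sum_noBrokenCircuitSets {R : Type*} [CommRing R] (o : LinearOrder G.edgeSet)
    (φ : Setoid (Fin N) → R) :
    ∑ S ∈ noBrokenCircuitSets G o, φ (componentSetoid (S : Set (Sym2 (Fin N)))) =
      ∑ S ∈ (edges G).powerset, (-1) ^ S.card *
        ((-1) ^ (N + Fintype.card (Quotient (componentSetoid (S : Set (Sym2 (Fin N)))))) *
          φ (componentSetoid (S : Set (Sym2 (Fin N))))) := by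
  rw [sum_powerset_eq_sum_noBrokenCircuit o
    (fun r => (-1) ^ (N + Fintype.card (Quotient r)) * φ r)]
  refine Finset.sum_congr rfl fun S hS => ?_
  obtain ⟨hS, hB⟩ := mem_noBrokenCircuitSets.1 hS
  have hcard := card_add_card_quotient (coe_subset_edgeSet hS)
    (hB.isAcyclic (coe_subset_edgeSet hS))
  rw [← mul_assoc, ← pow_add, ← add_assoc, add_right_comm, hcard, ← two_mul,
    Even.neg_one_pow (even_two_mul _), one_mul]

/-- The tree triple on the component `C` with the decoration `x`. -/
def componentTriple (hS : S ⊆ G.edgeSet) (hB : NoBrokenCircuit G o S)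
    (C : Quotient (componentSetoid S)) (x : Decoration (classSize C)) : TreeTriple G o where
  tree := componentTree S hS C
  comp := x.1.blocks
  r := x.2.val + 1
  isNBCTree := ⟨componentTree_isTree hS (hB.isAcyclic hS) C, fun B h hBT =>
    hB B h fun _ he => ((mem_edgeSet_componentTree hS).1 (hBT he)).1⟩
  comp_pos _ ha := x.1.blocks_pos ha
  comp_sum := x.1.blocks_sum
  one_le_r := Nat.succ_pos _
  r_le := x.2.2

theorem minVertex_componentTriple (hS : S ⊆ G.edgeSet) (hB : NoBrokenCircuit G o S) {v : Fin N}
    (hv : v ∈ minimalReps (componentSetoid S))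
    (x : Decoration (classSize (Quotient.mk (componentSetoid S) v))) :
    (componentTriple hS hB _ x).minVertex = v.val := by
  refine le_antisymm (Nat.sInf_le ⟨v, rfl, rfl⟩) (le_csInf ⟨_, v, rfl, rfl⟩ ?_)
  rintro _ ⟨w, hw, rfl⟩
  exact mem_minimalReps.1 hv w (Quotient.exact (Eq.symm hw))

theorem Decoration.ext {m : ℕ} {x y : Decoration m} (hblocks : x.1.blocks = y.1.blocks)
    (hr : x.2.val = y.2.val) : x = y := by
  obtain ⟨α, r⟩ := x
  obtain ⟨β, s⟩ := y
  obtain rfl : α = β := Composition.ext hblocks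
  exact congrArg (Sigma.mk α) (Fin.ext hr)

theorem componentTriple_inj (hS : S ⊆ G.edgeSet) (hB : NoBrokenCircuit G o S)
    {C C' : Quotient (componentSetoid S)} {x : Decoration (classSize C)}
    {x' : ∀ C, Decoration (classSize C)}
    (h : componentTriple hS hB C x = componentTriple hS hB C' (x' C')) : x = x' C := by
  have hverts : {v | Quotient.mk _ v = C} = {v | Quotient.mk _ v = C'} :=
    congrArg (fun A => A.tree.verts) h
  obtain ⟨v, rfl⟩ := Quotient.exists_rep C
  obtain rfl : Quotient.mk _ v = C' := (Set.ext_iff.1 hverts v).1 rfl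
  exact Decoration.ext (congrArg TreeTriple.comp h)
    (Nat.succ_injective (congrArg TreeTriple.r h))

end ComponentTree

section ForestTriples

variable {N : ℕ} {G : SimpleGraph (Fin N)} {o : LinearOrder G.edgeSet} {S : Set (Sym2 (Fin N))}

theorem TreeTriple.verts_nonempty (A : TreeTriple G o) : A.tree.verts.Nonempty := by
  obtain ⟨v⟩ := A.isNBCTree.1.connected.nonempty
  exact ⟨v.1, v.2⟩

theorem ForestTriple.exists_mem (F : ForestTriple G o) (v : Fin N) :
    ∃ A ∈ F.triples, v ∈ A.tree.verts := by
  obtain ⟨i, hi, -⟩ := F.existsUnique_mem v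
  exact ⟨_, List.get_mem _ _, hi⟩

theorem ForestTriple.eq_of_mem (F : ForestTriple G o) {v : Fin N} {A B : TreeTriple G o}
    (hA : A ∈ F.triples) (hB : B ∈ F.triples) (hvA : v ∈ A.tree.verts) (hvB : v ∈ B.tree.verts) :
    A = B := by
  obtain ⟨i, rfl⟩ := List.get_of_mem hA
  obtain ⟨j, rfl⟩ := List.get_of_mem hB
  rw [(F.existsUnique_mem v).unique hvA hvB]

theorem ForestTriple.nodup_triples (F : ForestTriple G o) : F.triples.Nodup :=
  F.sorted.imp fun h hAB => h.ne (congrArg TreeTriple.minVertex hAB)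

theorem ForestTriple.ext_of_mem_iff {F F' : ForestTriple G o}
    (h : ∀ A, A ∈ F.triples ↔ A ∈ F'.triples) : F = F' :=
  ForestTriple.ext <| List.Perm.eq_of_pairwise
    (fun _ _ _ _ hlt hgt => absurd (hlt.trans hgt) (lt_irrefl _)) F.sorted F'.sorted
    ((List.perm_ext_iff_of_nodup F.nodup_triples F'.nodup_triples).2 h)

/-- The forest triple whose trees are the components of `S`, decorated by `d`. -/
def forestTripleOf (hS : S ⊆ G.edgeSet) (hB : NoBrokenCircuit G o S)
    (d : ∀ C : Quotient (componentSetoid S), Decoration (classSize C)) : ForestTriple G o where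
  triples := ((minimalReps (componentSetoid S)).sort (· ≤ ·)).map fun v =>
    componentTriple hS hB (Quotient.mk _ v) (d _)
  existsUnique_mem v := by
    obtain ⟨w, hw, hwv⟩ := exists_minimalRep (Quotient.mk (componentSetoid S) v)
    obtain ⟨⟨i, hi⟩, hiw⟩ := List.get_of_mem ((Finset.mem_sort (· ≤ ·)).2 hw)
    simp only [List.get_eq_getElem] at hiw
    refine ⟨⟨i, by rwa [List.length_map]⟩, ?_, ?_⟩
    · rw [← hiw] at hwv
      simp only [List.get_eq_getElem, List.getElem_map]
      exact hwv.symm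
    · rintro ⟨j, hj⟩ hjv
      simp only [List.get_eq_getElem, List.getElem_map] at hjv
      rw [List.length_map] at hj
      have hwj := minimalReps_injOn hw ((Finset.mem_sort (· ≤ ·)).1 (List.getElem_mem hj))
        (hwv.trans hjv)
      exact Fin.ext (((Finset.sort_nodup _ _).getElem_inj_iff).1 (hiw.trans hwj)).symm
  sorted := by
    rw [List.pairwise_map]
    refine List.Pairwise.imp_of_mem (fun hv hw hlt => ?_)
      (Finset.sortedLT_sort (minimalReps (componentSetoid S))).pairwise
    rw [minVertex_componentTriple hS hB ((Finset.mem_sort (· ≤ ·)).1 hv),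
      minVertex_componentTriple hS hB ((Finset.mem_sort (· ≤ ·)).1 hw)]
    exact hlt

theorem mem_forestTripleOf {hS : S ⊆ G.edgeSet} {hB : NoBrokenCircuit G o S}
    {d : ∀ C : Quotient (componentSetoid S), Decoration (classSize C)} {A : TreeTriple G o} :
    A ∈ (forestTripleOf hS hB d).triples ↔ ∃ C, A = componentTriple hS hB C (d C) := by
  constructor
  · intro h
    obtain ⟨v, -, rfl⟩ := List.mem_map.1 h
    exact ⟨_, rfl⟩
  · rintro ⟨C, rfl⟩
    obtain ⟨v, hv, rfl⟩ := exists_minimalRep C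
    exact List.mem_map.2 ⟨v, (Finset.mem_sort _).2 hv, rfl⟩

theorem forestTripleOf_injective (hS : S ⊆ G.edgeSet) (hB : NoBrokenCircuit G o S) :
    Function.Injective (forestTripleOf (o := o) hS hB) := by
  intro d d' h
  funext C
  obtain ⟨C', hC'⟩ : ∃ C', componentTriple hS hB C (d C) = componentTriple hS hB C' (d' C') :=
    mem_forestTripleOf.1 (h ▸ mem_forestTripleOf.2 ⟨C, rfl⟩)
  exact componentTriple_inj hS hB hC'

/-- The set of all the edges of the trees of a forest triple. -/
def ForestTriple.edgeSet (F : ForestTriple G o) : Set (Sym2 (Fin N)) :=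
  {e | ∃ A ∈ F.triples, e ∈ A.tree.edgeSet}

theorem edgeSet_forestTripleOf {hS : S ⊆ G.edgeSet} {hB : NoBrokenCircuit G o S}
    {d : ∀ C : Quotient (componentSetoid S), Decoration (classSize C)} :
    (forestTripleOf hS hB d).edgeSet = S := by
  ext e
  constructor
  · rintro ⟨A, hA, he⟩
    obtain ⟨C, rfl⟩ := mem_forestTripleOf.1 hA
    exact ((mem_edgeSet_componentTree hS).1 he).1
  · intro he
    exact ⟨_, mem_forestTripleOf.2 ⟨_, rfl⟩, (mem_edgeSet_componentTree hS).2 ⟨he, rfl⟩⟩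

theorem ForestTriple.edgeSet_subset (F : ForestTriple G o) : F.edgeSet ⊆ G.edgeSet := by
  rintro e ⟨A, -, he⟩
  exact A.tree.edgeSet_subset he

theorem ForestTriple.adj_of_mem_edgeSet (F : ForestTriple G o) {a b : Fin N} {A : TreeTriple G o}
    (hA : A ∈ F.triples) (ha : a ∈ A.tree.verts) (h : s(a, b) ∈ F.edgeSet) : A.tree.Adj a b := by
  obtain ⟨B, hB, hab⟩ := h
  rw [F.eq_of_mem hA hB ha (SimpleGraph.Subgraph.mem_edgeSet.1 hab).fst_mem]
  exact hab

theorem ForestTriple.componentSetoid_iff (F : ForestTriple G o) {a b : Fin N} {A : TreeTriple G o}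
    (hA : A ∈ F.triples) (ha : a ∈ A.tree.verts) :
    componentSetoid F.edgeSet a b ↔ b ∈ A.tree.verts := by
  constructor
  · rintro ⟨p⟩
    induction p with
    | nil => exact ha
    | cons hadj _ ih =>
      exact ih (F.adj_of_mem_edgeSet hA ha ((SimpleGraph.fromEdgeSet_adj _).1 hadj).1).snd_mem
  · intro hb
    obtain ⟨p⟩ := A.isNBCTree.1.connected.preconnected ⟨a, ha⟩ ⟨b, hb⟩
    let f : A.tree.coe →g SimpleGraph.fromEdgeSet F.edgeSet := ⟨Subtype.val, fun {x y} hxy =>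
      (SimpleGraph.fromEdgeSet_adj _).2 ⟨⟨A, hA, hxy⟩, (A.tree.adj_sub hxy).ne⟩⟩
    exact ⟨p.map f⟩

/-- If an edge is active, then the smaller edges connecting its ends lie in one of the trees. -/
theorem ForestTriple.noBrokenCircuit (F : ForestTriple G o) :
    NoBrokenCircuit G o F.edgeSet := by
  by_contra hF
  obtain ⟨e, u, v, huv, ⟨p⟩⟩ := not_noBrokenCircuit_iff.1 hF
  obtain ⟨A, hA, hu⟩ := F.exists_mem u
  refine not_noBrokenCircuit_iff.2 ⟨e, u, v, huv, ?_⟩ A.isNBCTree.2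
  clear huv
  induction p with
  | nil => exact SimpleGraph.Reachable.refl _
  | cons hadj _ ih =>
    have hbelow := ((SimpleGraph.fromEdgeSet_adj _).1 hadj).1
    have hab := F.adj_of_mem_edgeSet hA hu hbelow.1
    exact Setoid.trans' _ (componentSetoid_of_mem ⟨hab, hbelow.2⟩) (ih hab.snd_mem)

theorem ForestTriple.exists_componentTriple_mem (F : ForestTriple G o)
    (C : Quotient (componentSetoid F.edgeSet)) : ∃ x : Decoration (classSize C),
      componentTriple F.edgeSet_subset F.noBrokenCircuit C x ∈ F.triples := by
  obtain ⟨v, rfl⟩ := Quotient.exists_rep C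
  obtain ⟨A, hA, hv⟩ := F.exists_mem v
  have hverts : {w | Quotient.mk (componentSetoid F.edgeSet) w = Quotient.mk _ v} =
      A.tree.verts := by
    ext w
    rw [← F.componentSetoid_iff hA hv]
    exact ⟨fun h => Quotient.exact (Eq.symm h), fun h => (Quotient.sound h).symm⟩
  have htree : componentTree F.edgeSet F.edgeSet_subset (Quotient.mk _ v) = A.tree := by
    refine SimpleGraph.Subgraph.ext hverts (funext₂ fun a b => propext ⟨?_, fun hab => ?_⟩)
    · rintro ⟨hab, ha⟩
      exact F.adj_of_mem_edgeSet hA ((Set.ext_iff.1 hverts a).1 ha) hab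
    · exact ⟨⟨A, hA, hab⟩, (Set.ext_iff.1 hverts a).2 hab.fst_mem⟩
  refine ⟨⟨⟨A.comp, fun {a} ha => A.comp_pos a ha, A.comp_sum.trans (by rw [classSize, hverts])⟩,
    ⟨A.r - 1, (Nat.sub_one_lt_of_le A.one_le_r A.r_le :)⟩⟩, ?_⟩
  convert hA
  exact TreeTriple.ext htree rfl (Nat.sub_add_cancel A.one_le_r)

theorem ForestTriple.exists_eq_forestTripleOf (F : ForestTriple G o) (hF : F.edgeSet = S)
    (hS : S ⊆ G.edgeSet) (hB : NoBrokenCircuit G o S) : ∃ d, forestTripleOf hS hB d = F := by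
  subst hF
  choose d hd using F.exists_componentTriple_mem
  refine ⟨d, ForestTriple.ext_of_mem_iff fun A => mem_forestTripleOf.trans ⟨?_, fun hA => ?_⟩⟩
  · rintro ⟨C, rfl⟩
    exact hd C
  · obtain ⟨v, hv⟩ := A.verts_nonempty
    exact ⟨Quotient.mk _ v, F.eq_of_mem hA (hd _) hv rfl⟩

/-- The decompositions of forest triples into an edge set without broken circuits and decorations
of its components. -/
def forestTripleEquiv (G : SimpleGraph (Fin N)) (o : LinearOrder G.edgeSet) :
    (Σ S : noBrokenCircuitSets G o, ∀ C : Quotient (componentSetoid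
      ((S : Finset (Sym2 (Fin N))) : Set (Sym2 (Fin N)))), Decoration (classSize C)) ≃
      ForestTriple G o :=
  Equiv.ofBijective (fun x => forestTripleOf
      (coe_subset_edgeSet (mem_noBrokenCircuitSets.1 x.1.2).1)
      (mem_noBrokenCircuitSets.1 x.1.2).2 x.2) <| by
    constructor
    · rintro ⟨S, d⟩ ⟨S', d'⟩ h
      have hS := congrArg ForestTriple.edgeSet h
      simp only [edgeSet_forestTripleOf] at hS
      obtain rfl : S = S' := Subtype.ext (Finset.coe_injective hS)
      exact congrArg (Sigma.mk S) (forestTripleOf_injective _ _ h)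
    · intro F
      have hcoe : (F.edgeSet.toFinite.toFinset : Set (Sym2 (Fin N))) = F.edgeSet :=
        Set.Finite.coe_toFinset _
      have hmem : F.edgeSet.toFinite.toFinset ∈ noBrokenCircuitSets G o := by
        rw [mem_noBrokenCircuitSets, hcoe]
        exact ⟨fun e he => mem_edges.2 (F.edgeSet_subset ((Set.Finite.mem_toFinset _).1 he)),
          F.noBrokenCircuit⟩
      obtain ⟨d, hd⟩ := F.exists_eq_forestTripleOf hcoe.symm
        (coe_subset_edgeSet (mem_noBrokenCircuitSets.1 hmem).1) (mem_noBrokenCircuitSets.1 hmem).2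
      exact ⟨⟨⟨_, hmem⟩, d⟩, hd⟩

end ForestTriples

/-! ### The weight of a forest triple -/

section Weight

variable {N : ℕ} {G : SimpleGraph (Fin N)} {o : LinearOrder G.edgeSet} {S : Set (Sym2 (Fin N))}

theorem elementaryProd_sum {I : Type*} (s : Finset I) (f : I → Multiset ℕ) :
    elementaryProd (∑ i ∈ s, f i) = ∏ i ∈ s, elementaryProd (f i) := by
  rw [elementaryProd, ← Multiset.coe_mapAddMonoidHom, map_sum, Multiset.prod_sum]
  rfl

/-- The vertex `0` can only lie in the first tree of a forest triple. -/
theorem ForestTriple.firstPart_eq (F : ForestTriple G o) {A : TreeTriple G o} (hA : A ∈ F.triples)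
    {v : Fin N} (hv : v ∈ A.tree.verts) (hv0 : v.val = 0) : F.firstPart = A.comp.headD 0 := by
  have hmin : A.minVertex = 0 := Nat.le_zero.1 (Nat.sInf_le ⟨v, hv, hv0⟩)
  have hsorted := F.sorted
  unfold ForestTriple.firstPart
  cases hL : F.triples with
  | nil => exact absurd (hL ▸ hA) List.not_mem_nil
  | cons B L =>
    rw [hL] at hA hsorted
    rcases List.mem_cons.1 hA with rfl | hA
    · rfl
    · exact absurd ((List.pairwise_cons.1 hsorted).1 A hA) (by omega)

theorem type_forestTripleOf (hS : S ⊆ G.edgeSet) (hB : NoBrokenCircuit G o S)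
    (d : ∀ C : Quotient (componentSetoid S), Decoration (classSize C)) :
    (forestTripleOf hS hB d).type = ∑ C, ((d C).1.blocks : Multiset ℕ) := by
  rw [ForestTriple.type, ← Multiset.coe_bind, Multiset.bind, Multiset.join, Multiset.map_coe,
    Multiset.sum_coe, forestTripleOf, List.map_map]
  exact sum_map_sort_minimalReps fun C => ((d C).1.blocks : Multiset ℕ)

theorem sign_forestTripleOf (hS : S ⊆ G.edgeSet) (hB : NoBrokenCircuit G o S)
    (d : ∀ C : Quotient (componentSetoid S), Decoration (classSize C)) :
    (forestTripleOf hS hB d).sign = ∏ C, (-1) ^ ((d C).1.blocks.length - 1) := by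
  rw [ForestTriple.sign, Finset.prod_pow_eq_pow_sum, forestTripleOf, List.map_map]
  exact congrArg _ (sum_map_sort_minimalReps fun C => (d C).1.blocks.length - 1)

theorem Decoration.headD_cons_tail {m : ℕ} (x : Decoration m) :
    x.1.blocks.headD 0 :: x.1.blocks.tail = x.1.blocks := by
  obtain ⟨α, r⟩ := x
  cases h : α.blocks with
  | nil => exact absurd r.pos (by simp [h])
  | cons a l => rfl

open Classical in
theorem reducedType_forestTripleOf (hS : S ⊆ G.edgeSet) (hB : NoBrokenCircuit G o S)
    (d : ∀ C : Quotient (componentSetoid S), Decoration (classSize C)) {x : Fin N}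
    (hx : x.val = 0) :
    (forestTripleOf hS hB d).reducedType = ∑ C,
      ((if Quotient.mk _ x = C then (d C).1.blocks.tail else (d C).1.blocks : List ℕ) :
        Multiset ℕ) := by
  set C₀ : Quotient (componentSetoid S) := Quotient.mk _ x
  have hfirst : (forestTripleOf hS hB d).firstPart = (d C₀).1.blocks.headD 0 :=
    ForestTriple.firstPart_eq _ (mem_forestTripleOf.2 ⟨C₀, rfl⟩)
      (show x ∈ {v | Quotient.mk _ v = C₀} from rfl) hx
  rw [ForestTriple.reducedType, hfirst, type_forestTripleOf,
    ← Finset.add_sum_erase _ _ (Finset.mem_univ C₀),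
    ← Finset.add_sum_erase _ _ (Finset.mem_univ C₀), if_pos rfl,
    ← (d C₀).headD_cons_tail, ← Multiset.cons_coe, Multiset.cons_add, List.headD_cons,
    Multiset.erase_cons_head, List.tail_cons]
  refine congrArg _ (Finset.sum_congr rfl fun C hC => ?_)
  rw [if_neg (Finset.ne_of_mem_erase hC).symm]

open Classical in
theorem sign_smul_elementaryProd_reducedType (hS : S ⊆ G.edgeSet) (hB : NoBrokenCircuit G o S)
    (d : ∀ C : Quotient (componentSetoid S), Decoration (classSize C)) {x : Fin N}
    (hx : x.val = 0) :
    (forestTripleOf hS hB d).sign • elementaryProd (forestTripleOf hS hB d).reducedType =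
      ∏ C, ((-1) ^ ((d C).1.blocks.length - 1) *
        ((if Quotient.mk _ x = C then (d C).1.blocks.tail else (d C).1.blocks).map
          elementary).prod) := by
  rw [reducedType_forestTripleOf hS hB d hx, elementaryProd_sum, sign_forestTripleOf,
    Finset.prod_mul_distrib, zsmul_eq_mul]
  simp only [elementaryProd_coe]
  push_cast
  rfl

end Weight

section Entries

variable {n : ℕ} {G : SimpleGraph (Fin n)} {i j : ℕ+}
  {o : LinearOrder (glue G (SimpleGraph.pathGraph (j : ℕ))).edgeSet}
  {S : Set (Sym2 (Fin (n + j - 1)))} {x z : Fin (n + j - 1)}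

theorem forestTripleOf_mem_restrictedForestTriples
    {hS : S ⊆ (glue G (SimpleGraph.pathGraph (j : ℕ))).edgeSet} {hB : NoBrokenCircuit _ o S}
    {d : ∀ C : Quotient (componentSetoid S), Decoration (classSize C)} (hx : x.val = 0)
    (hz : z.val = n - 1) :
    forestTripleOf hS hB d ∈ restrictedForestTriples G i j o ↔
      (∀ v : Fin (n + j - 1), n - 1 ≤ v.val → componentSetoid S z v) ∧
        ∀ C, (Quotient.mk (componentSetoid S) x = C →
          (d C).1.blocks.headD 0 = i ∧ (d C).2.val = 0) ∧
          (Quotient.mk (componentSetoid S) z = C → j ≤ (d C).1.blocks.getLastD 0) := by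
  constructor
  · rintro ⟨⟨A, hA, ⟨v, hv, hv0⟩, hhead, hr⟩, A', hA', ⟨v', hv', hvz⟩, hpath, hlast⟩
    obtain rfl : v = x := Fin.ext (hv0.trans hx.symm)
    obtain rfl : v' = z := Fin.ext (hvz.trans hz.symm)
    obtain ⟨C, rfl⟩ := mem_forestTripleOf.1 hA
    obtain ⟨C', rfl⟩ := mem_forestTripleOf.1 hA'
    obtain rfl : Quotient.mk _ v = C := hv
    obtain rfl : Quotient.mk _ v' = C' := hv'
    refine ⟨fun w hw => Quotient.exact (Eq.symm (hpath w hw)), fun C => ⟨?_, ?_⟩⟩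
    · rintro rfl
      exact ⟨hhead, Nat.succ_injective hr⟩
    · rintro rfl
      exact hlast
  · rintro ⟨hpath, hd⟩
    obtain ⟨hhead, hr⟩ := (hd _).1 rfl
    exact ⟨⟨_, mem_forestTripleOf.2 ⟨_, rfl⟩, ⟨x, rfl, hx⟩, hhead, congrArg Nat.succ hr⟩,
      _, mem_forestTripleOf.2 ⟨_, rfl⟩, ⟨z, rfl, hz⟩,
      fun v hv => (Quotient.sound (hpath v hv)).symm, (hd _).2 rfl⟩

open Classical in
theorem indicator_restrictedForestTriples
    (hS : S ⊆ (glue G (SimpleGraph.pathGraph (j : ℕ))).edgeSet) (hB : NoBrokenCircuit _ o S)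
    (d : ∀ C : Quotient (componentSetoid S), Decoration (classSize C)) (hx : x.val = 0)
    (hz : z.val = n - 1) :
    (restrictedForestTriples G i j o).indicator
        (fun F => F.sign • elementaryProd F.reducedType) (forestTripleOf hS hB d) =
      if ∀ v : Fin (n + j - 1), n - 1 ≤ v.val → componentSetoid S z v then
        ∏ C, decorationWeight elementary i j (Quotient.mk (componentSetoid S) x = C)
          (Quotient.mk (componentSetoid S) z = C) (d C) else 0 := by
  rw [Set.indicator_apply, sign_smul_elementaryProd_reducedType hS hB d hx]
  simp only [forestTripleOf_mem_restrictedForestTriples hx hz, decorationWeight]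
  rw [ite_and]
  refine if_congr Iff.rfl ?_ rfl
  split_ifs with h
  · refine Finset.prod_congr rfl fun C _ => ?_
    rw [if_pos (h C)]
    congr!
  · obtain ⟨C, hC⟩ := not_forall.1 h
    exact (Finset.prod_eq_zero (Finset.mem_univ C) (if_neg hC)).symm

open Classical in
/-- The total contribution to the entry `(i, j)` of the forest triple matrix of all the decorations
of an edge set of `G + P_j` with components `r`, where `x` is the first vertex of `G` and `z` the
last one. -/
def componentWeight (i j : ℕ+) (x z : Fin (n + j - 1)) (r : Setoid (Fin (n + j - 1))) :
    PowerSeriesRing :=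
  if ∀ v : Fin (n + j - 1), n - 1 ≤ v.val → r z v then
    ∏ C : Quotient r,
      treeWeight elementary i j (Quotient.mk r x = C) (Quotient.mk r z = C) (classSize C)
  else 0

theorem forestTripleMatrix_eq_sum_noBrokenCircuitSets (G : SimpleGraph (Fin n))
    (o : ∀ j : ℕ+, LinearOrder (glue G (SimpleGraph.pathGraph (j : ℕ))).edgeSet) (i j : ℕ+)
    {x z : Fin (n + j - 1)} (hx : x.val = 0) (hz : z.val = n - 1) :
    forestTripleMatrix G o i j = ∑ S ∈ noBrokenCircuitSets _ (o j),
      componentWeight i j x z (componentSetoid (S : Set (Sym2 (Fin (n + j - 1))))) := by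
  classical
  rw [forestTripleMatrix, finsum_mem_def, ← finsum_comp_equiv (forestTripleEquiv _ (o j)),
    finsum_eq_sum_of_fintype, Fintype.sum_sigma,
    ← Finset.sum_coe_sort (noBrokenCircuitSets _ (o j))]
  refine Finset.sum_congr rfl fun S _ => (Finset.sum_congr rfl fun d _ =>
    indicator_restrictedForestTriples (coe_subset_edgeSet (mem_noBrokenCircuitSets.1 S.2).1)
      (mem_noBrokenCircuitSets.1 S.2).2 d hx hz).trans ?_
  rw [componentWeight]
  split_ifs with h
  · simp only [treeWeight]
    rw [Finset.prod_univ_sum, Fintype.piFinset_univ]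
  · exact Finset.sum_const_zero

end Entries

/-! ### Attaching a path -/

section PathAttachment

variable {n j : ℕ}

/-- The inclusion of the vertices of `G` into those of `G + P_j`. -/
def inclusion (hj : 0 < j) (u : Fin n) : Fin (n + j - 1) := ⟨u.val, by omega⟩

/-- The map that contracts the path of `G + P_j` to the last vertex of `G`. -/
def contraction (hn : 0 < n) (v : Fin (n + j - 1)) : Fin n := ⟨min v.val (n - 1), by omega⟩

/-- The edges of the path in `G + P_j`. -/
def pathEdge (hn : 0 < n) (u : Fin (j - 1)) : Sym2 (Fin (n + j - 1)) :=
  s(⟨n - 1 + u.val, by omega⟩, ⟨n - 1 + u.val + 1, by omega⟩)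

variable (hn : 0 < n) (hj : 0 < j)

theorem contraction_inclusion (u : Fin n) : contraction hn (inclusion hj u) = u :=
  Fin.ext (min_eq_left (Nat.le_sub_one_of_lt u.2))

theorem inclusion_injective : Function.Injective (inclusion (n := n) hj) :=
  fun _ _ h => Fin.ext (Fin.mk.inj h)

theorem inclusion_contraction {v : Fin (n + j - 1)} (hv : v.val < n) :
    inclusion hj (contraction hn v) = v :=
  Fin.ext (min_eq_left (Nat.le_sub_one_of_lt hv))

theorem contraction_of_le {z : Fin n} (hz : z.val = n - 1) {v : Fin (n + j - 1)}
    (hv : n - 1 ≤ v.val) : contraction hn v = z :=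
  Fin.ext ((min_eq_right hv).trans hz.symm)

theorem ncard_preimage_contraction (hj : 0 < j) {z : Fin n} (hz : z.val = n - 1) (A : Set (Fin n))
    [Decidable (z ∈ A)] :
    (contraction (j := j) hn ⁻¹' A).ncard = A.ncard + if z ∈ A then j - 1 else 0 := by
  set B := contraction (j := j) hn ⁻¹' A with hB
  have hinter : (B ∩ Set.range (inclusion hj)).ncard = A.ncard := by
    rw [← Set.image_preimage_eq_inter_range,
      Set.ncard_image_of_injective _ (inclusion_injective hj)]
    congr 1
    ext u
    rw [hB, Set.mem_preimage, Set.mem_preimage, contraction_inclusion]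
  have houtside {v : Fin (n + j - 1)} (hv : v ∉ Set.range (inclusion (n := n) hj)) :
      contraction hn v = z := by
    refine contraction_of_le hn hz ?_
    by_contra! h
    exact hv ⟨_, inclusion_contraction hn hj (by omega)⟩
  have hdiff : (B \ Set.range (inclusion hj)).ncard = if z ∈ A then j - 1 else 0 := by
    split_ifs with h
    · have : B \ Set.range (inclusion hj) = (Set.range (inclusion hj))ᶜ :=
        Set.ext fun v => and_iff_right_of_imp fun hv => by
          rwa [hB, Set.mem_preimage, houtside hv]
      rw [this, Set.ncard_compl, Set.ncard_range_of_injective (inclusion_injective hj),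
        Nat.card_fin, Nat.card_fin]
      omega
    · rw [Set.ncard_eq_zero, Set.eq_empty_iff_forall_notMem]
      rintro v ⟨hv, hv'⟩
      exact h (houtside hv' ▸ hv)
  rw [← Set.ncard_inter_add_ncard_sdiff_eq_ncard B (Set.range (inclusion hj)), hinter, hdiff]

theorem pathEdge_injective : Function.Injective (pathEdge (j := j) hn) := by
  intro u v h
  simp only [pathEdge, Sym2.eq_iff, Fin.mk.injEq] at h
  exact Fin.ext (by omega)

theorem map_inclusion_ne_pathEdge (f : Sym2 (Fin n)) (u : Fin (j - 1)) :
    f.map (inclusion hj) ≠ pathEdge hn u := by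
  induction f with
  | _ a b =>
    intro h
    simp only [Sym2.map_mk, pathEdge, inclusion, Sym2.eq_iff, Fin.mk.injEq] at h
    omega

open Classical in
/-- The edge set of `G + P_j` that consists of an edge set of `G` and the edges of the path. -/
def addPath (S : Finset (Sym2 (Fin n))) : Finset (Sym2 (Fin (n + j - 1))) :=
  S.image (Sym2.map (inclusion hj)) ∪ Finset.univ.image (pathEdge hn)

variable {S : Finset (Sym2 (Fin n))}

theorem mem_addPath {e : Sym2 (Fin (n + j - 1))} :
    e ∈ addPath hn hj S ↔ (∃ f ∈ S, f.map (inclusion hj) = e) ∨ ∃ u, pathEdge hn u = e := by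
  simp [addPath]

theorem map_inclusion_mem_addPath {f : Sym2 (Fin n)} :
    f.map (inclusion hj) ∈ addPath hn hj S ↔ f ∈ S := by
  rw [mem_addPath]
  constructor
  · rintro (⟨g, hg, h⟩ | ⟨u, h⟩)
    · rwa [← Sym2.map.injective (inclusion_injective hj) h]
    · exact absurd h.symm (map_inclusion_ne_pathEdge hn hj f u)
  · exact fun h => Or.inl ⟨f, h, rfl⟩

theorem pathEdge_mem_addPath (u : Fin (j - 1)) : pathEdge hn u ∈ addPath hn hj S :=
  (mem_addPath hn hj).2 (Or.inr ⟨u, rfl⟩)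

theorem addPath_injective : Function.Injective (addPath (n := n) hn hj) := by
  intro S T h
  ext f
  rw [← map_inclusion_mem_addPath hn hj, h, map_inclusion_mem_addPath]

theorem card_addPath (S : Finset (Sym2 (Fin n))) :
    (addPath hn hj S).card = S.card + (j - 1) := by
  classical
  rw [addPath, Finset.card_union_of_disjoint, Finset.card_image_of_injective _
    (Sym2.map.injective (inclusion_injective hj)),
    Finset.card_image_of_injective _ (pathEdge_injective hn), Finset.card_univ, Fintype.card_fin]
  rw [Finset.disjoint_left]
  intro e he he'
  obtain ⟨f, -, rfl⟩ := Finset.mem_image.1 he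
  obtain ⟨u, -, hu⟩ := Finset.mem_image.1 he'
  exact map_inclusion_ne_pathEdge hn hj f u hu.symm

theorem componentSetoid_addPath_le (S : Finset (Sym2 (Fin n))) :
    componentSetoid (addPath hn hj S : Set (Sym2 (Fin (n + j - 1)))) ≤
      (componentSetoid (S : Set (Sym2 (Fin n)))).comap (contraction hn) := by
  rw [componentSetoid_le_iff]
  intro a b hab
  rw [Setoid.comap_rel]
  rcases (mem_addPath hn hj).1 (Finset.mem_coe.1 hab) with ⟨f, hf, h⟩ | ⟨u, h⟩
  · have hf' : s(contraction hn a, contraction hn b) = f := by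
      rw [← Sym2.map_mk, ← h, Sym2.map_map, (funext (contraction_inclusion hn hj) : _ ∘ _ = id),
        Sym2.map_id, id]
    exact componentSetoid_of_mem (hf' ▸ hf)
  · have hab' : contraction hn a = contraction hn b := by
      simp only [pathEdge, Sym2.eq_iff, Fin.ext_iff] at h
      simp only [contraction, Fin.mk.injEq]
      omega
    rw [hab']

theorem componentSetoid_addPath_inclusion_contraction (S : Finset (Sym2 (Fin n)))
    (v : Fin (n + j - 1)) :
    componentSetoid (addPath hn hj S : Set (Sym2 (Fin (n + j - 1))))
      (inclusion hj (contraction hn v)) v := by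
  set r := componentSetoid (addPath hn hj S : Set (Sym2 (Fin (n + j - 1))))
  let z : Fin n := ⟨n - 1, by omega⟩
  have hpath (m : ℕ) (hm : n - 1 + m < n + j - 1) : r (inclusion hj z) ⟨n - 1 + m, hm⟩ := by
    induction m with
    | zero => exact r.refl _
    | succ m ih =>
      exact r.trans (ih (by omega)) (componentSetoid_of_mem
        (Finset.mem_coe.2 (pathEdge_mem_addPath hn hj ⟨m, by omega⟩)))
  rcases lt_or_ge v.val n with hv | hv
  · rw [inclusion_contraction hn hj hv]
  · have hv' : n - 1 ≤ v.val := by omega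
    obtain ⟨v, hvlt⟩ := v
    obtain ⟨m, rfl⟩ := Nat.exists_eq_add_of_le hv'
    rw [contraction_of_le hn (show z.val = n - 1 from rfl) hv']
    exact hpath m hvlt

theorem componentSetoid_addPath (S : Finset (Sym2 (Fin n))) :
    componentSetoid (addPath hn hj S : Set (Sym2 (Fin (n + j - 1)))) =
      (componentSetoid (S : Set (Sym2 (Fin n)))).comap (contraction hn) := by
  refine le_antisymm (componentSetoid_addPath_le hn hj S) fun a b hab => ?_
  set r := componentSetoid (addPath hn hj S : Set (Sym2 (Fin (n + j - 1))))
  have hincl : componentSetoid (S : Set (Sym2 (Fin n))) ≤ r.comap (inclusion hj) :=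
    componentSetoid_le_iff.2 fun c d hcd => componentSetoid_of_mem
      (Finset.mem_coe.2 ((map_inclusion_mem_addPath hn hj (f := s(c, d))).2 hcd))
  have hcontr := componentSetoid_addPath_inclusion_contraction hn hj S
  exact r.trans (r.symm (hcontr a)) (r.trans (hincl hab) (hcontr b))

variable {G : SimpleGraph (Fin n)}

theorem mem_edges_glue_pathGraph {e : Sym2 (Fin (n + j - 1))} :
    e ∈ edges (glue G (SimpleGraph.pathGraph j)) ↔ e ∈ addPath hn hj (edges G) := by
  rw [mem_edges, mem_addPath]
  constructor
  · induction e with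
    | _ a b =>
      rintro (⟨u, v, huv, ha, hb⟩ | ⟨u, v, huv, ha, hb⟩)
      · refine Or.inl ⟨s(u, v), mem_edges.2 huv, ?_⟩
        rw [Sym2.map_mk, show inclusion hj u = a from Fin.ext ha.symm,
          show inclusion hj v = b from Fin.ext hb.symm]
      · right
        simp only at ha hb
        simp only [pathEdge, Sym2.eq_iff, Fin.ext_iff, ha, hb]
        rcases SimpleGraph.pathGraph_adj.1 huv with h | h
        · exact ⟨⟨u.val, by omega⟩, by simp only; omega⟩
        · exact ⟨⟨v.val, by omega⟩, by simp only; omega⟩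
  · rintro (⟨f, hf, rfl⟩ | ⟨u, rfl⟩)
    · induction f with
      | _ a b => exact Or.inl ⟨a, b, mem_edges.1 hf, rfl, rfl⟩
    · refine Or.inr ⟨⟨u.val, by omega⟩, ⟨u.val + 1, by omega⟩, ?_, ?_, ?_⟩
      · exact SimpleGraph.pathGraph_adj.2 (Or.inl rfl)
      · simp only
        omega
      · simp only
        omega

theorem addPath_subset_edges_glue (hS : S ⊆ edges G) :
    addPath hn hj S ⊆ edges (glue G (SimpleGraph.pathGraph j)) := by
  classical
  intro e he
  rw [mem_edges_glue_pathGraph hn hj]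
  exact Finset.union_subset_union_left (Finset.image_mono _ hS) he

theorem pathEdge_mem_of_componentSetoid (hj : 0 < j) {T : Finset (Sym2 (Fin (n + j - 1)))}
    (hT : T ⊆ edges (glue G (SimpleGraph.pathGraph j))) {z : Fin (n + j - 1)}
    (h : ∀ v : Fin (n + j - 1), n - 1 ≤ v.val →
      componentSetoid (T : Set (Sym2 (Fin (n + j - 1)))) z v) (u : Fin (j - 1)) :
    pathEdge hn u ∈ T := by
  -- Every edge of the path is a bridge of `G + P_j`.
  by_contra hu
  have hcut : componentSetoid (T : Set (Sym2 (Fin (n + j - 1)))) ≤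
      Setoid.comap (fun v => v.val ≤ n - 1 + u.val) ⊥ := by
    rw [componentSetoid_le_iff]
    intro a b hab
    refine propext (?_ : a.val ≤ n - 1 + u.val ↔ b.val ≤ n - 1 + u.val)
    rcases (mem_addPath hn hj).1 ((mem_edges_glue_pathGraph hn hj).1 (hT hab)) with
      ⟨f, -, hf⟩ | ⟨w, hw⟩
    · induction f with
      | _ c d =>
        simp only [Sym2.map_mk, inclusion, Sym2.eq_iff, Fin.ext_iff] at hf
        omega
    · have hwu : w.val ≠ u.val := fun h' => hu (Fin.ext h' ▸ hw ▸ hab)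
      simp only [pathEdge, Sym2.eq_iff, Fin.ext_iff] at hw
      omega
  have hends := Setoid.trans' _
    (Setoid.symm' _ (h ⟨n - 1 + u.val, by omega⟩ (Nat.le_add_right _ _)))
    (h ⟨n - 1 + u.val + 1, by omega⟩ (by simp only; omega))
  exact absurd ((hcut hends : (_ ≤ _) = (_ ≤ _)).mp le_rfl) (Nat.not_succ_le_self _)

theorem exists_eq_addPath {T : Finset (Sym2 (Fin (n + j - 1)))}
    (hT : T ⊆ edges (glue G (SimpleGraph.pathGraph j))) {z : Fin (n + j - 1)}
    (h : ∀ v : Fin (n + j - 1), n - 1 ≤ v.val →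
      componentSetoid (T : Set (Sym2 (Fin (n + j - 1)))) z v) :
    ∃ S ⊆ edges G, addPath hn hj S = T := by
  classical
  refine ⟨(edges G).filter fun f => f.map (inclusion hj) ∈ T, Finset.filter_subset _ _, ?_⟩
  ext e
  rw [mem_addPath]
  constructor
  · rintro (⟨f, hf, rfl⟩ | ⟨u, rfl⟩)
    · exact (Finset.mem_filter.1 hf).2
    · exact pathEdge_mem_of_componentSetoid hn hj hT h u
  · intro he
    refine ((mem_addPath hn hj).1 ((mem_edges_glue_pathGraph hn hj).1 (hT he))).imp ?_ id
    rintro ⟨f, hf, rfl⟩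
    exact ⟨f, Finset.mem_filter.2 ⟨hf, he⟩, rfl⟩

/-- The bijection between the classes of the setoid on `G + P_j` pulled back from `r` and the
classes of `r`. -/
def contractClass (r : Setoid (Fin n)) :
    Quotient (r.comap (contraction (j := j) hn)) → Quotient r :=
  Quotient.map' (contraction hn) fun _ _ h => h

theorem contractClass_bijective (hj : 0 < j) (r : Setoid (Fin n)) :
    Function.Bijective (contractClass (j := j) hn r) := by
  constructor
  · intro C D h
    obtain ⟨a, rfl⟩ := Quotient.exists_rep C
    obtain ⟨b, rfl⟩ := Quotient.exists_rep D
    exact Quotient.sound (s := r.comap (contraction hn)) (Quotient.exact (s := r) h)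
  · intro C
    obtain ⟨a, rfl⟩ := Quotient.exists_rep C
    exact ⟨Quotient.mk _ (inclusion hj a),
      congrArg (Quotient.mk r) (contraction_inclusion hn hj a)⟩

theorem mk_eq_iff_mk_contraction_eq (hj : 0 < j) (r : Setoid (Fin n)) (v : Fin (n + j - 1))
    (C : Quotient (r.comap (contraction (j := j) hn))) :
    Quotient.mk _ v = C ↔ Quotient.mk r (contraction hn v) = contractClass hn r C :=
  (contractClass_bijective hn hj r).1.eq_iff.symm

open Classical in
theorem classSize_comap_contraction (hj : 0 < j) (r : Setoid (Fin n)) {z : Fin n}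
    (hz : z.val = n - 1) (C : Quotient (r.comap (contraction (j := j) hn))) :
    classSize C = classSize (contractClass hn r C) +
      if Quotient.mk r z = contractClass hn r C then j - 1 else 0 := by
  rw [classSize, Set.ext fun v => mk_eq_iff_mk_contraction_eq hn hj r v C]
  exact ncard_preimage_contraction hn hj hz {u | Quotient.mk r u = contractClass hn r C}

open Classical in
theorem prod_treeWeight_comap_contraction {R : Type*} [CommRing R] (e : ℕ → R) (k : ℕ)
    (r : Setoid (Fin n)) (x : Fin n) {z : Fin n} (hz : z.val = n - 1) :
    ∏ C : Quotient (r.comap (contraction (j := j) hn)), treeWeight e k j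
        (Quotient.mk _ (inclusion hj x) = C) (Quotient.mk _ (inclusion hj z) = C) (classSize C) =
      ∏ C : Quotient r, treeWeight e k j (Quotient.mk r x = C) (Quotient.mk r z = C)
        (classSize C + if Quotient.mk r z = C then j - 1 else 0) := by
  refine Fintype.prod_bijective _ (contractClass_bijective hn hj r) _ _ fun C => ?_
  rw [mk_eq_iff_mk_contraction_eq hn hj, mk_eq_iff_mk_contraction_eq hn hj, contraction_inclusion,
    contraction_inclusion, classSize_comap_contraction hn hj r hz]

end PathAttachment

open Classical in
/-- The path must lie in a single component and its edges are bridges, so they belong to every edge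
set that contributes. -/
theorem forestTripleMatrix_eq_sum_powerset {n : ℕ} (G : SimpleGraph (Fin n))
    (o : ∀ j : ℕ+, LinearOrder (glue G (SimpleGraph.pathGraph (j : ℕ))).edgeSet) (i j : ℕ+)
    {x z : Fin n} (hx : x.val = 0) (hz : z.val = n - 1) :
    forestTripleMatrix G o i j = ∑ S ∈ (edges G).powerset, (-1) ^ S.card *
      ((-1) ^ (n + Fintype.card (Quotient (componentSetoid (S : Set (Sym2 (Fin n)))))) *
        ∏ C : Quotient (componentSetoid (S : Set (Sym2 (Fin n)))),
          treeWeight elementary i j (Quotient.mk _ x = C) (Quotient.mk _ z = C)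
            (classSize C + if Quotient.mk _ z = C then (j : ℕ) - 1 else 0)) := by
  have hj : 0 < (j : ℕ) := j.pos
  have hn : 0 < n := x.pos
  rw [forestTripleMatrix_eq_sum_noBrokenCircuitSets G o i j
    (show (inclusion hj x).val = 0 from hx) (show (inclusion hj z).val = n - 1 from hz),
    sum_noBrokenCircuitSets]
  symm
  refine Finset.sum_of_injOn (addPath hn hj) (addPath_injective hn hj).injOn
    (fun S hS => Finset.mem_coe.2 (Finset.mem_powerset.2
      (addPath_subset_edges_glue hn hj (Finset.mem_powerset.1 (Finset.mem_coe.1 hS)))))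
    (fun T hT hT' => ?_) fun S _ => ?_
  · rw [componentWeight, if_neg, mul_zero, mul_zero]
    intro h
    obtain ⟨S, hS, hST⟩ := exists_eq_addPath hn hj (Finset.mem_powerset.1 hT) h
    exact hT' ⟨S, Finset.mem_coe.2 (Finset.mem_powerset.2 hS), hST⟩
  · have hpath (v : Fin (n + j - 1)) (hv : n - 1 ≤ v.val) :
        (componentSetoid (S : Set (Sym2 (Fin n)))).comap (contraction hn) (inclusion hj z) v := by
      rw [Setoid.comap_rel, contraction_inclusion, contraction_of_le hn hz hv]
    have hsign (c : ℕ) : (-1 : PowerSeriesRing) ^ (S.card + (j - 1) + (n + j - 1 + c)) =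
        (-1) ^ (S.card + (n + c)) := by
      rw [show S.card + (j - 1) + (n + j - 1 + c) = 2 * (j - 1) + (S.card + (n + c)) by omega,
        pow_add, Even.neg_one_pow (even_two_mul _), one_mul]
    rw [componentSetoid_addPath, componentWeight, if_pos hpath, card_addPath,
      Fintype.card_of_bijective (contractClass_bijective hn hj _),
      prod_treeWeight_comap_contraction hn hj elementary i _ x hz, ← mul_assoc, ← mul_assoc,
      ← pow_add, ← pow_add, hsign]

/-! ### The chromatic symmetric function of `G°` -/

section Multigraph

variable {α β V : Type*} [Finite V]

theorem finsum_single_mk (r : Setoid V) (f : Quotient r → ℕ+) :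
    ∑ᶠ v, Finsupp.single (f (Quotient.mk r v)) 1 = ∑ C, Finsupp.single (f C) (classSize C) := by
  classical
  have := Fintype.ofFinite V
  rw [finsum_eq_sum_of_fintype, ← Finset.sum_fiberwise Finset.univ (Quotient.mk r)]
  refine Finset.sum_congr rfl fun C _ => ?_
  rw [Finset.sum_congr rfl fun v hv => by rw [(Finset.mem_filter.1 hv).2], Finset.sum_const,
    Finsupp.smul_single, smul_eq_mul, mul_one, classSize, ← Set.ncard_coe_finset,
    Finset.coe_filter_univ]

theorem coeff_prod_powerSum_classSize (r : Setoid V) (d : ℕ+ →₀ ℕ) :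
    MvPowerSeries.coeff d (∏ C : Quotient r, powerSum (classSize C)) =
      (Nat.card {κ : V → ℕ+ // r ≤ Setoid.ker κ ∧ ∑ᶠ v, Finsupp.single (κ v) 1 = d} : ℤ) := by
  rw [coeff_prod_powerSum _ classSize_pos, Nat.cast_inj]
  refine Nat.card_congr (.trans ?_ (Equiv.subtypeSubtypeEquivSubtypeInter _ _))
  refine (Setoid.liftEquiv r).symm.subtypeEquiv fun f => ?_
  rw [← finsum_single_mk]
  rfl

theorem finite_setOf_finsum_single_eq (d : ℕ+ →₀ ℕ) :
    {κ : V → ℕ+ | ∑ᶠ v, Finsupp.single (κ v) 1 = d}.Finite := by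
  have := Fintype.ofFinite V
  refine Set.Finite.subset (Set.Finite.pi' fun _ : V => d.support.finite_toSet) ?_
  rintro κ rfl v
  rw [finsum_eq_sum_of_fintype, Finset.mem_coe, Finsupp.mem_support_iff, Finsupp.finsetSum_apply]
  exact (Finset.sum_pos' (fun _ _ => Nat.zero_le _)
    ⟨v, Finset.mem_univ v, by simp only [Finsupp.single_eq_same, one_pos]⟩).ne'

/-- The partition of the vertices of a multigraph into the components of the edge set `S`. -/
def linkSetoid (M : Graph α β) (S : Set β) : Setoid M.vertexSet :=
  Relation.EqvGen.setoid fun x y => ∃ e ∈ S, M.IsLink e x y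

theorem linkSetoid_le_iff {M : Graph α β} {S : Set β} {r : Setoid M.vertexSet} :
    linkSetoid M S ≤ r ↔ ∀ e ∈ S, ∀ x y : M.vertexSet, M.IsLink e x y → r x y :=
  ⟨fun h e he x y hxy => h (.rel x y ⟨e, he, hxy⟩),
    fun h => Setoid.eqvGen_le fun x y ⟨e, he, hxy⟩ => h e he x y hxy⟩

theorem isProperColouring_iff {M : Graph α β} {κ : M.vertexSet → ℕ+} : IsProperColouring M κ ↔
    ∀ e ∈ M.edgeSet, ¬∀ x y : M.vertexSet, M.IsLink e x y → κ x = κ y := by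
  constructor
  · intro h e he hκ
    obtain ⟨x, y, hxy⟩ := Graph.exists_isLink_of_mem_edgeSet he
    exact h e ⟨x, hxy.left_mem⟩ ⟨y, hxy.right_mem⟩ hxy (hκ _ _ hxy)
  · intro h e x y hxy hκ
    refine h e hxy.edge_mem fun x' y' hxy' => ?_
    rcases hxy.eq_and_eq_or_eq_and_eq hxy' with ⟨hx, hy⟩ | ⟨hx, hy⟩
    · rw [← Subtype.ext hx, ← Subtype.ext hy, hκ]
    · rw [← Subtype.ext hx, ← Subtype.ext hy, hκ]

open Classical in
theorem sum_powerset_linkSetoid_le_ker {M : Graph α β} {E : Finset β}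
    (hE : ∀ e, e ∈ E ↔ e ∈ M.edgeSet) (κ : M.vertexSet → ℕ+) :
    ∑ S ∈ E.powerset, (if linkSetoid M (S : Set β) ≤ Setoid.ker κ then (-1) ^ S.card else 0 : ℤ) =
      if IsProperColouring M κ then 1 else 0 := by
  have hpowerset : E.powerset.filter (fun S : Finset β =>
      linkSetoid M (S : Set β) ≤ Setoid.ker κ) =
      (E.filter fun e => ∀ x y : M.vertexSet, M.IsLink e x y → κ x = κ y).powerset := by
    ext S
    simp only [Finset.mem_filter, Finset.mem_powerset, linkSetoid_le_iff, Finset.subset_iff,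
      Finset.mem_coe, Setoid.ker_def, forall_and]
  rw [← Finset.sum_filter, hpowerset, Finset.sum_powerset_neg_one_pow_card]
  simp only [Finset.filter_eq_empty_iff, isProperColouring_iff, hE]

open Classical in
/-- Stanley's power-sum expansion, for multigraphs. -/
theorem chromaticSymmetricFunction_eq_sum_powerset [Finite α] (M : Graph α β) {E : Finset β}
    (hE : ∀ e, e ∈ E ↔ e ∈ M.edgeSet) :
    chromaticSymmetricFunction M = ∑ S ∈ E.powerset,
      (-1) ^ S.card * ∏ C : Quotient (linkSetoid M (S : Set β)), powerSum (classSize C) := by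
  ext d
  have hfin := finite_setOf_finsum_single_eq (V := M.vertexSet) d
  have hcard (P : (M.vertexSet → ℕ+) → Prop) :
      (Nat.card {κ : M.vertexSet → ℕ+ // P κ ∧ ∑ᶠ v, Finsupp.single (κ v) 1 = d} : ℤ) =
        ∑ κ ∈ hfin.toFinset, if P κ then 1 else 0 := by
    rw [Finset.sum_boole, Nat.cast_inj, ← Nat.card_eq_finsetCard]
    refine Nat.card_congr (Equiv.subtypeEquivRight fun κ => ?_)
    rw [Finset.mem_filter, Set.Finite.mem_toFinset, and_comm]
    rfl
  have hcoeff (S : Finset β) : MvPowerSeries.coeff d ((-1) ^ S.card *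
      ∏ C : Quotient (linkSetoid M (S : Set β)), powerSum (classSize C)) =
      ∑ κ ∈ hfin.toFinset,
        if linkSetoid M (S : Set β) ≤ Setoid.ker κ then (-1) ^ S.card else 0 := by
    have hsign : (-1 : PowerSeriesRing) ^ S.card = MvPowerSeries.C ((-1) ^ S.card) := by
      rw [map_pow, map_neg, map_one]
    rw [hsign, MvPowerSeries.coeff_C_mul, coeff_prod_powerSum_classSize, hcard, Finset.mul_sum]
    exact Finset.sum_congr rfl fun κ _ => mul_boole _ _
  rw [map_sum, Finset.sum_congr rfl fun S _ => hcoeff S, Finset.sum_comm,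
    Finset.sum_congr rfl fun κ _ => sum_powerset_linkSetoid_le_ker hE κ]
  exact hcard _

end Multigraph

section CloseUp

variable {n : ℕ} {r : Setoid (Fin n)} {x z : Fin n}

open Classical in
/-- The class of `v` after the class of `z` has been merged into the class of `x`. -/
def mergedClass (r : Setoid (Fin n)) (x z v : Fin n) : Quotient r :=
  if Quotient.mk r v = Quotient.mk r z then Quotient.mk r x else Quotient.mk r v

theorem mergedClass_eq_of_rel {a b : Fin n} (h : r a b) :
    mergedClass r x z a = mergedClass r x z b := by
  rw [mergedClass, mergedClass, Quotient.sound (s := r) h]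

theorem mergedClass_left : mergedClass r x z x = Quotient.mk r x := ite_self _

theorem mergedClass_right : mergedClass r x z z = Quotient.mk r x := if_pos rfl

theorem mergedClass_eq_left_iff {v : Fin n} : mergedClass r x z v = Quotient.mk r x ↔
    Quotient.mk r v = Quotient.mk r x ∨ Quotient.mk r v = Quotient.mk r z := by
  rw [mergedClass]
  split_ifs with h <;> simp only [h, or_true, or_false]

theorem mergedClass_eq_iff {v : Fin n} {C : Quotient r} (hx : Quotient.mk r x ≠ C)
    (hz : Quotient.mk r z ≠ C) : mergedClass r x z v = C ↔ Quotient.mk r v = C := by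
  rw [mergedClass]
  split_ifs with h
  · rw [h, iff_false_right hz]
    exact hx
  · rfl

/-- The number of vertices other than `z` in the classes of `x` and `z`, that is, the size of the
class of `G°` that contains the glued vertex. -/
def mergedClassSize (r : Setoid (Fin n)) (x z : Fin n) : ℕ :=
  {v | Quotient.mk r v = Quotient.mk r x ∨ Quotient.mk r v = Quotient.mk r z}.ncard - 1

open Classical in
/-- The classes that contain neither `x` nor `z`. -/
def otherClasses (r : Setoid (Fin n)) (x z : Fin n) : Finset (Quotient r) :=
  (Finset.univ.erase (Quotient.mk r z)).erase (Quotient.mk r x)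

theorem mem_otherClasses {C : Quotient r} :
    C ∈ otherClasses r x z ↔ Quotient.mk r x ≠ C ∧ Quotient.mk r z ≠ C := by
  simp only [otherClasses, Finset.mem_erase, Finset.mem_univ, and_true, ne_comm]

theorem classSize_ker {W Q : Type*} {f : W → Q} (C : Quotient (Setoid.ker f)) :
    classSize C = (f ⁻¹' {Setoid.kerLift f C}).ncard :=
  congrArg Set.ncard (Set.ext fun w =>
    ((Setoid.kerLift_injective f).eq_iff (a := Quotient.mk _ w) (b := C)).symm)

variable {W : Type*} {ι : W → Fin n}

theorem ncard_preimage_mergedClass_left (hinj : Function.Injective ι)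
    (hrange : Set.range ι = {z}ᶜ) :
    (mergedClass r x z ∘ ι ⁻¹' {Quotient.mk r x}).ncard = mergedClassSize r x z := by
  have hz : z ∈ mergedClass r x z ⁻¹' {Quotient.mk r x} := mergedClass_right
  rw [mergedClassSize, Set.preimage_comp, ← Set.ncard_image_of_injective _ hinj,
    Set.image_preimage_eq_inter_range, hrange, ← Set.sdiff_eq,
    Set.ncard_sdiff_singleton_of_mem hz]
  simp only [← mergedClass_eq_left_iff]
  rfl

theorem ncard_preimage_mergedClass_of_mem_otherClasses (hinj : Function.Injective ι)
    (hrange : Set.range ι = {z}ᶜ) {C : Quotient r} (hC : C ∈ otherClasses r x z) :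
    (mergedClass r x z ∘ ι ⁻¹' {C}).ncard = classSize C := by
  obtain ⟨hx, hz⟩ := mem_otherClasses.1 hC
  have hclass : mergedClass r x z ⁻¹' {C} = {v | Quotient.mk r v = C} :=
    Set.ext fun v => mergedClass_eq_iff hx hz
  have hzC : z ∉ {v | Quotient.mk r v = C} := hz
  rw [classSize, Set.preimage_comp, ← Set.ncard_image_of_injective _ hinj,
    Set.image_preimage_eq_inter_range, hclass, hrange,
    Set.inter_eq_left.2 (Set.subset_compl_singleton_iff.2 hzC)]

theorem range_mergedClass_comp [DecidableEq (Quotient r)] (hrange : Set.range ι = {z}ᶜ)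
    (hxz : x ≠ z) : Set.range (mergedClass r x z ∘ ι) =
      (insert (Quotient.mk r x) (otherClasses r x z) : Finset (Quotient r)) := by
  rw [Set.range_comp, hrange, Finset.coe_insert]
  ext C
  constructor
  · rintro ⟨v, -, rfl⟩
    by_cases hv : Quotient.mk r v = Quotient.mk r x ∨ Quotient.mk r v = Quotient.mk r z
    · exact Or.inl (mergedClass_eq_left_iff.2 hv)
    · rw [mergedClass, if_neg fun h => hv (Or.inr h)]
      exact Or.inr (mem_otherClasses.2 ⟨fun h => hv (Or.inl h.symm), fun h => hv (Or.inr h.symm)⟩)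
  · rintro (rfl | hC)
    · exact ⟨x, hxz, mergedClass_left⟩
    · obtain ⟨hx, hz⟩ := mem_otherClasses.1 hC
      obtain ⟨v, rfl⟩ := Quotient.exists_rep C
      exact ⟨v, fun h => hz (congrArg (Quotient.mk r) h.symm), (mergedClass_eq_iff hx hz).2 rfl⟩

theorem prod_classSize_ker_mergedClass {R : Type*} [CommMonoid R] [Finite W]
    (hinj : Function.Injective ι) (hrange : Set.range ι = {z}ᶜ) (hxz : x ≠ z) (f : ℕ → R) :
    ∏ C : Quotient (Setoid.ker (mergedClass r x z ∘ ι)), f (classSize C) =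
      f (mergedClassSize r x z) * ∏ C ∈ otherClasses r x z, f (classSize C) := by
  classical
  set F := mergedClass r x z ∘ ι
  have hnot : Quotient.mk r x ∉ otherClasses r x z := fun h => (mem_otherClasses.1 h).1 rfl
  have himage : Finset.univ.image (Setoid.kerLift F) =
      insert (Quotient.mk r x) (otherClasses r x z) := by
    apply Finset.coe_injective
    rw [Finset.coe_image, Finset.coe_univ, Set.image_univ, Setoid.range_kerLift_eq_range,
      range_mergedClass_comp hrange hxz]
  calc ∏ C : Quotient (Setoid.ker F), f (classSize C)
      = ∏ C ∈ insert (Quotient.mk r x) (otherClasses r x z), f (F ⁻¹' {C}).ncard := by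
        rw [← himage, Finset.prod_image (Setoid.kerLift_injective F).injOn]
        simp only [classSize_ker]
    _ = f (mergedClassSize r x z) * ∏ C ∈ otherClasses r x z, f (classSize C) := by
        rw [Finset.prod_insert hnot, ncard_preimage_mergedClass_left hinj hrange]
        exact congrArg _ (Finset.prod_congr rfl fun C hC => by
          rw [ncard_preimage_mergedClass_of_mem_otherClasses hinj hrange hC])

variable (hn : 2 ≤ n) (G : SimpleGraph (Fin n))

/-- The vertex of `G` other than the last one that a vertex of `G°` comes from. -/
def closeUpRep (w : (closeUp hn G).vertexSet) : Fin n := ⟨w.1.val, by omega⟩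

/-- The vertex of `G°` that a vertex of `G` is glued to. -/
def closeUpMk (v : Fin n) : (closeUp hn G).vertexSet := ⟨identifyEnds hn v, trivial⟩

theorem closeUpMk_closeUpRep (w : (closeUp hn G).vertexSet) :
    closeUpMk hn G (closeUpRep hn G w) = w :=
  Subtype.ext (dif_pos w.1.2)

theorem closeUpRep_injective : Function.Injective (closeUpRep hn G) :=
  Function.LeftInverse.injective (closeUpMk_closeUpRep hn G)

theorem closeUpRep_closeUpMk_of_ne (hz : z.val = n - 1) {v : Fin n} (hv : v ≠ z) :
    closeUpRep hn G (closeUpMk hn G v) = v := by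
  have hlt : v.val < n - 1 := by
    have := Fin.val_ne_of_ne hv
    omega
  exact Fin.ext (congrArg (fun w : Fin (n - 1) => w.val) (dif_pos hlt))

theorem closeUpRep_closeUpMk_last (hx : x.val = 0) (hz : z.val = n - 1) :
    closeUpRep hn G (closeUpMk hn G z) = x :=
  Fin.ext ((congrArg (fun w : Fin (n - 1) => w.val) (dif_neg hz.not_lt)).trans hx.symm)

theorem range_closeUpRep (hz : z.val = n - 1) : Set.range (closeUpRep hn G) = {z}ᶜ := by
  refine Set.Subset.antisymm ?_ fun v hv => ⟨_, closeUpRep_closeUpMk_of_ne hn G hz hv⟩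
  rintro _ ⟨w, rfl⟩ h
  exact (w.1.2.trans_eq hz.symm).ne (congrArg Fin.val h)

theorem mergedClass_closeUpRep_closeUpMk (hx : x.val = 0) (hz : z.val = n - 1) (v : Fin n) :
    mergedClass r x z (closeUpRep hn G (closeUpMk hn G v)) = mergedClass r x z v := by
  rcases eq_or_ne v z with rfl | hv
  · rw [closeUpRep_closeUpMk_last hn G hx hz, mergedClass_left, mergedClass_right]
  · rw [closeUpRep_closeUpMk_of_ne hn G hz hv]

theorem closeUpMk_eq_closeUpMk (hx : x.val = 0) (hz : z.val = n - 1) :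
    closeUpMk hn G x = closeUpMk hn G z := by
  rw [← closeUpRep_closeUpMk_last hn G hx hz, closeUpMk_closeUpRep]

variable {G} {S : Set (Sym2 (Fin n))}

theorem linkSetoid_closeUpMk (hS : S ⊆ G.edgeSet) {a b : Fin n} (h : componentSetoid S a b) :
    linkSetoid (closeUp hn G) S (closeUpMk hn G a) (closeUpMk hn G b) := by
  have hle : componentSetoid S ≤ (linkSetoid (closeUp hn G) S).comap (closeUpMk hn G) :=
    componentSetoid_le_iff.2 fun a b hab => .rel _ _ ⟨s(a, b), hab, hS hab, rfl⟩
  exact hle h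

theorem linkSetoid_closeUpMk_of_mergedClass_eq (hx : x.val = 0) (hz : z.val = n - 1)
    (hS : S ⊆ G.edgeSet) (v : Fin n) {a : Fin n}
    (h : mergedClass (componentSetoid S) x z v = Quotient.mk _ a) :
    linkSetoid (closeUp hn G) S (closeUpMk hn G v) (closeUpMk hn G a) := by
  rw [mergedClass] at h
  split_ifs at h with hv
  · have hvz := linkSetoid_closeUpMk hn hS (Quotient.exact hv)
    rw [← closeUpMk_eq_closeUpMk hn G hx hz] at hvz
    exact hvz.trans _ _ _ (linkSetoid_closeUpMk hn hS (Quotient.exact h))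
  · exact linkSetoid_closeUpMk hn hS (Quotient.exact h)

theorem linkSetoid_closeUp (hx : x.val = 0) (hz : z.val = n - 1) (hS : S ⊆ G.edgeSet) :
    linkSetoid (closeUp hn G) S =
      Setoid.ker (mergedClass (componentSetoid S) x z ∘ closeUpRep hn G) := by
  refine le_antisymm (linkSetoid_le_iff.2 ?_) fun w w' h => ?_
  · rintro e he w w' ⟨-, hww'⟩
    induction e with | _ a b
    have hab := mergedClass_eq_of_rel (x := x) (z := z) (componentSetoid_of_mem he)
    rw [← mergedClass_closeUpRep_closeUpMk hn G hx hz a,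
      ← mergedClass_closeUpRep_closeUpMk hn G hx hz b] at hab
    rcases Sym2.eq_iff.1 hww' with ⟨ha, hb⟩ | ⟨ha, hb⟩
    · rwa [show closeUpMk hn G a = w from Subtype.ext ha,
        show closeUpMk hn G b = w' from Subtype.ext hb] at hab
    · rw [show closeUpMk hn G a = w' from Subtype.ext ha,
        show closeUpMk hn G b = w from Subtype.ext hb] at hab
      exact hab.symm
  · obtain ⟨a, ha⟩ := Quotient.exists_rep
      (mergedClass (componentSetoid S) x z (closeUpRep hn G w'))
    rw [← closeUpMk_closeUpRep hn G w, ← closeUpMk_closeUpRep hn G w']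
    exact Setoid.trans' _
      (linkSetoid_closeUpMk_of_mergedClass_eq hn hx hz hS _ (Eq.trans h ha.symm))
      (Setoid.symm' _ (linkSetoid_closeUpMk_of_mergedClass_eq hn hx hz hS _ ha.symm))

theorem chromaticSymmetricFunction_closeUp (hx : x.val = 0) (hz : z.val = n - 1) :
    chromaticSymmetricFunction (closeUp hn G) = ∑ S ∈ (edges G).powerset, (-1) ^ S.card *
      (powerSum (mergedClassSize (componentSetoid (S : Set (Sym2 (Fin n)))) x z) *
        ∏ C ∈ otherClasses (componentSetoid (S : Set (Sym2 (Fin n)))) x z,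
          powerSum (classSize C)) := by
  have hxz : x ≠ z := fun h => by
    have := congrArg Fin.val h
    omega
  rw [chromaticSymmetricFunction_eq_sum_powerset (E := edges G)]
  · refine Finset.sum_congr rfl fun S hS => ?_
    rw [← prod_classSize_ker_mergedClass (closeUpRep_injective hn G) (range_closeUpRep hn G hz) hxz,
      linkSetoid_closeUp hn hx hz (coe_subset_edgeSet (Finset.mem_powerset.1 hS))]
  · intro e
    rw [mem_edges]
    exact ⟨fun he => e.ind (fun a b he => ⟨_, _, he, rfl⟩) he, fun ⟨_, _, he, _⟩ => he⟩

end CloseUp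

/-! ### The trace -/

section Trace

variable {n : ℕ} {r : Setoid (Fin n)} {x z : Fin n}

theorem mergedClassSize_pos (hxz : x ≠ z) : 0 < mergedClassSize r x z := by
  refine Nat.sub_pos_of_lt ?_
  rw [Nat.lt_iff_add_one_le, one_add_one_eq_two, ← Set.ncard_pair hxz]
  refine Set.ncard_le_ncard ?_ (Set.toFinite _)
  rintro v (rfl | rfl)
  exacts [Or.inl rfl, Or.inr rfl]

theorem mergedClassSize_lt : mergedClassSize r x z < n := by
  have hle := Set.ncard_le_card
    {v | Quotient.mk r v = Quotient.mk r x ∨ Quotient.mk r v = Quotient.mk r z}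
  rw [Nat.card_fin] at hle
  have hn := x.pos
  rw [mergedClassSize]
  omega

theorem classSize_of_eq (h : Quotient.mk r x = Quotient.mk r z) :
    classSize (Quotient.mk r z) = mergedClassSize r x z + 1 := by
  simp only [mergedClassSize, h, or_self]
  exact (Nat.sub_add_cancel (classSize_pos _)).symm

theorem classSize_add_classSize_of_ne (h : Quotient.mk r x ≠ Quotient.mk r z) :
    classSize (Quotient.mk r x) + classSize (Quotient.mk r z) = mergedClassSize r x z + 1 := by
  have hdisj : Disjoint {v | Quotient.mk r v = Quotient.mk r x}
      {v | Quotient.mk r v = Quotient.mk r z} :=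
    Set.disjoint_left.2 fun v hx hz => h (Eq.trans (Eq.symm hx) hz)
  have hpos := classSize_pos (Quotient.mk r x)
  rw [mergedClassSize, Set.ofPred_or, Set.ncard_union_eq hdisj]
  exact (Nat.sub_add_cancel (Nat.add_pos_left hpos _)).symm

theorem prod_of_eq {M : Type*} [CommMonoid M] (h : Quotient.mk r x = Quotient.mk r z)
    (f : Quotient r → M) : ∏ C, f C = f (Quotient.mk r z) * ∏ C ∈ otherClasses r x z, f C := by
  classical
  rw [otherClasses, h, Finset.erase_idem, Finset.mul_prod_erase _ _ (Finset.mem_univ _)]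

theorem prod_of_ne {M : Type*} [CommMonoid M] (h : Quotient.mk r x ≠ Quotient.mk r z)
    (f : Quotient r → M) :
    ∏ C, f C = f (Quotient.mk r x) * f (Quotient.mk r z) * ∏ C ∈ otherClasses r x z, f C := by
  classical
  rw [otherClasses, mul_right_comm,
    Finset.mul_prod_erase _ _ (Finset.mem_erase.2 ⟨h, Finset.mem_univ _⟩), mul_comm,
    Finset.mul_prod_erase _ _ (Finset.mem_univ _)]

open Classical in
/-- Up to sign, the contribution to the entry `(k, k)` of the forest triple matrix of an edge set
of `G` with components `r`, where `x` and `z` are the first and the last vertex. -/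
def diagonalProduct (r : Setoid (Fin n)) (x z : Fin n) (k : ℕ) : PowerSeriesRing :=
  ∏ C : Quotient r, treeWeight elementary k k (Quotient.mk r x = C) (Quotient.mk r z = C)
    (classSize C + if Quotient.mk r z = C then k - 1 else 0)

open Classical in
theorem prod_otherClasses_treeWeight (k : ℕ) :
    ∏ C ∈ otherClasses r x z, treeWeight elementary k k (Quotient.mk r x = C)
      (Quotient.mk r z = C) (classSize C + if Quotient.mk r z = C then k - 1 else 0) =
      ∏ C ∈ otherClasses r x z, signedPowerSum elementary (classSize C) := by
  refine Finset.prod_congr rfl fun C hC => ?_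
  obtain ⟨hx, hz⟩ := mem_otherClasses.1 hC
  rw [treeWeight_of_not_of_not _ _ _ hx hz, if_neg hz, add_zero]

theorem diagonalProduct_of_eq (h : Quotient.mk r x = Quotient.mk r z) (k : ℕ) :
    diagonalProduct r x z (k + 1) =
      treeWeight elementary (k + 1) (k + 1) True True (k + 1 + mergedClassSize r x z) *
        ∏ C ∈ otherClasses r x z, signedPowerSum elementary (classSize C) := by
  rw [diagonalProduct, prod_of_eq h, prod_otherClasses_treeWeight, if_pos rfl, classSize_of_eq h,
    Nat.add_sub_cancel, add_assoc, add_comm 1 k, add_comm (mergedClassSize r x z),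
    eq_true h, eq_self]

theorem diagonalProduct_of_ne (h : Quotient.mk r x ≠ Quotient.mk r z) (k : ℕ) :
    diagonalProduct r x z (k + 1) =
      treeWeight elementary (k + 1) (k + 1) True False (classSize (Quotient.mk r x)) *
        treeWeight elementary (k + 1) (k + 1) False True (classSize (Quotient.mk r z) + k) *
        ∏ C ∈ otherClasses r x z, signedPowerSum elementary (classSize C) := by
  rw [diagonalProduct, prod_of_ne h, prod_otherClasses_treeWeight, if_pos rfl, if_neg h.symm,
    Nat.add_sub_cancel, add_zero, eq_false h, eq_false h.symm, eq_self, eq_self]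

theorem diagonalProduct_eq_zero (hxz : x ≠ z) {k : ℕ} (hk : n ≤ k + 1) :
    diagonalProduct r x z (k + 1) = 0 := by
  have hlt := mergedClassSize_lt (r := r) (x := x) (z := z)
  by_cases h : Quotient.mk r x = Quotient.mk r z
  · rw [diagonalProduct_of_eq h,
      treeWeight_of_mem_of_mem _ trivial trivial (mergedClassSize_pos hxz),
      Finset.sum_eq_zero, neg_zero, zero_mul]
    intro s hs
    have hsm := (Finset.mem_Icc.1 hs).2
    exact if_neg (by omega)
  · have hsum := classSize_add_classSize_of_ne h
    have hpos := classSize_pos (Quotient.mk r z)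
    rw [diagonalProduct_of_ne h, treeWeight_of_mem_of_not _ _ k.succ_pos trivial not_false,
      if_neg (by omega), zero_mul, zero_mul]

theorem sum_diagonalProduct_of_eq (hxz : x ≠ z) (h : Quotient.mk r x = Quotient.mk r z) :
    ∑ k ∈ Finset.range (n - 1), diagonalProduct r x z (k + 1) =
      -signedPowerSum elementary (mergedClassSize r x z) *
        ∏ C ∈ otherClasses r x z, signedPowerSum elementary (classSize C) := by
  rw [Finset.sum_congr rfl fun k _ => diagonalProduct_of_eq h k, ← Finset.sum_mul,
    sum_treeWeight _ (mergedClassSize_pos hxz) (Nat.le_sub_one_of_lt mergedClassSize_lt)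
      trivial trivial]

theorem sum_diagonalProduct_of_ne (h : Quotient.mk r x ≠ Quotient.mk r z) :
    ∑ k ∈ Finset.range (n - 1), diagonalProduct r x z (k + 1) =
      signedPowerSum elementary (mergedClassSize r x z) *
        ∏ C ∈ otherClasses r x z, signedPowerSum elementary (classSize C) := by
  have hsum := classSize_add_classSize_of_ne h
  have hpos := classSize_pos (Quotient.mk r z)
  have hlt := mergedClassSize_lt (r := r) (x := x) (z := z)
  rw [Finset.sum_congr rfl fun k _ => diagonalProduct_of_ne h k, ← Finset.sum_mul,
    sum_treeWeight_mul_treeWeight elementary_zero (classSize_pos _) hpos (by omega) trivial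
      not_false not_false trivial, hsum, Nat.add_sub_cancel]

theorem neg_one_pow_mul_signedPowerSum_elementary {m : ℕ} (hm : 0 < m) :
    (-1) ^ (m + 1) * signedPowerSum elementary m = powerSum m := by
  rw [signedPowerSum_elementary hm, ← mul_assoc, ← pow_add,
    Even.neg_one_pow ⟨m, by omega⟩, one_mul]

theorem neg_one_pow_add_card_quotient (R : Type*) [CommRing R] (r : Setoid (Fin n)) :
    (-1 : R) ^ (n + Fintype.card (Quotient r)) = ∏ C : Quotient r, (-1) ^ (classSize C + 1) := by
  rw [Finset.prod_pow_eq_pow_sum, Finset.sum_add_distrib, sum_classSize, Nat.card_fin,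
    Finset.sum_const, Finset.card_univ, smul_eq_mul, mul_one]

theorem neg_one_pow_mul_sum_diagonalProduct (hxz : x ≠ z) :
    (-1) ^ (n + Fintype.card (Quotient r)) *
        ∑ k ∈ Finset.range (n - 1), diagonalProduct r x z (k + 1) =
      powerSum (mergedClassSize r x z) * ∏ C ∈ otherClasses r x z, powerSum (classSize C) := by
  have hother : ∏ C ∈ otherClasses r x z, powerSum (classSize C) =
      (∏ C ∈ otherClasses r x z, (-1) ^ (classSize C + 1)) *
        ∏ C ∈ otherClasses r x z, signedPowerSum elementary (classSize C) := by
    rw [← Finset.prod_mul_distrib]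
    exact Finset.prod_congr rfl fun C _ =>
      (neg_one_pow_mul_signedPowerSum_elementary (classSize_pos C)).symm
  rw [neg_one_pow_add_card_quotient, hother,
    ← neg_one_pow_mul_signedPowerSum_elementary (mergedClassSize_pos hxz)]
  by_cases h : Quotient.mk r x = Quotient.mk r z
  · rw [prod_of_eq h, sum_diagonalProduct_of_eq hxz h, classSize_of_eq h]
    ring
  · rw [prod_of_ne h, sum_diagonalProduct_of_ne h, ← pow_add, add_add_add_comm,
      classSize_add_classSize_of_ne h]
    ring

end Trace

theorem infiniteTrace_eq_sum_range {M : Matrix ℕ+ ℕ+ PowerSeriesRing} {m : ℕ}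
    (h : ∀ k : ℕ+, m < k → M k k = 0) :
    infiniteTrace M = ∑ k ∈ Finset.range m, M k.succPNat k.succPNat := by
  classical
  rw [infiniteTrace, finsum_eq_sum_of_support_subset (s := (Finset.range m).image Nat.succPNat),
    Finset.sum_image Nat.succPNat_injective.injOn]
  intro k hk
  have hkm : (k : ℕ) ≤ m := not_lt.1 fun h' => hk (h k h')
  have hpos := k.pos
  refine Finset.mem_coe.2 (Finset.mem_image.2 ⟨k.natPred, ?_, k.succPNat_natPred⟩)
  rw [Finset.mem_range, PNat.natPred]
  omega

theorem exists_first_ne_last {n : ℕ} (hn : 2 ≤ n) :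
    ∃ x z : Fin n, x.val = 0 ∧ z.val = n - 1 ∧ x ≠ z :=
  ⟨⟨0, by omega⟩, ⟨n - 1, by omega⟩, rfl, rfl, Fin.ne_of_val_ne (by simp only; omega)⟩

section Diagonal

variable {n : ℕ} (G : SimpleGraph (Fin n))
  (o : ∀ j : ℕ+, LinearOrder (glue G (SimpleGraph.pathGraph (j : ℕ))).edgeSet)

theorem forestTripleMatrix_diagonal (k : ℕ) {x z : Fin n} (hx : x.val = 0) (hz : z.val = n - 1) :
    forestTripleMatrix G o k.succPNat k.succPNat = ∑ S ∈ (edges G).powerset, (-1) ^ S.card *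
      ((-1) ^ (n + Fintype.card (Quotient (componentSetoid (S : Set (Sym2 (Fin n)))))) *
        diagonalProduct (componentSetoid (S : Set (Sym2 (Fin n)))) x z (k + 1)) :=
  forestTripleMatrix_eq_sum_powerset G o _ _ hx hz

theorem forestTripleMatrix_diagonal_eq_zero (hn : 2 ≤ n) (k : ℕ+) (hk : n ≤ k) :
    forestTripleMatrix G o k k = 0 := by
  obtain ⟨x, z, hx, hz, hxz⟩ := exists_first_ne_last hn
  rw [← k.succPNat_natPred, forestTripleMatrix_diagonal G o _ hx hz]
  refine Finset.sum_eq_zero fun S _ => ?_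
  rw [diagonalProduct_eq_zero hxz (by rwa [PNat.natPred_add_one]), mul_zero, mul_zero]

theorem sum_forestTripleMatrix_diagonal (hn : 2 ≤ n) :
    ∑ k ∈ Finset.range (n - 1), forestTripleMatrix G o k.succPNat k.succPNat =
      chromaticSymmetricFunction (closeUp hn G) := by
  obtain ⟨x, z, hx, hz, hxz⟩ := exists_first_ne_last hn
  rw [chromaticSymmetricFunction_closeUp hn hx hz,
    Finset.sum_congr rfl fun k _ => forestTripleMatrix_diagonal G o k hx hz, Finset.sum_comm]
  refine Finset.sum_congr rfl fun S _ => ?_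
  rw [← Finset.mul_sum, ← Finset.mul_sum, neg_one_pow_mul_sum_diagonalProduct hxz]

end Diagonal

end ForestTriples

end

theorem mainTheorem3 (n : ℕ) (hn : 2 ≤ n) (G : SimpleGraph (Fin n))
    (o : ∀ j : ℕ+, LinearOrder
      (ForestTriples.glue G (SimpleGraph.pathGraph (j : ℕ))).edgeSet) :
    (∀ k : ℕ+, n ≤ (k : ℕ) → ForestTriples.forestTripleMatrix G o k k = 0) ∧
    ForestTriples.chromaticSymmetricFunction (ForestTriples.closeUp hn G) =
      ForestTriples.infiniteTrace (ForestTriples.forestTripleMatrix G o) ∧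
    ForestTriples.infiniteTrace (ForestTriples.forestTripleMatrix G o) =
      ∑ k ∈ Finset.range (n - 1),
        ForestTriples.forestTripleMatrix G o k.succPNat k.succPNat := by
  have hzero := ForestTriples.forestTripleMatrix_diagonal_eq_zero G o hn
  have htrace := ForestTriples.infiniteTrace_eq_sum_range (m := n - 1)
    (M := ForestTriples.forestTripleMatrix G o) fun k hk => hzero k (by omega)
  exact ⟨hzero, (htrace.trans (ForestTriples.sum_forestTripleMatrix_diagonal G o hn)).symm, htrace⟩
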